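/- Let $M$ be an $n$-dimensional $C^\infty$ manifold and let $L:TM\to\mathbb R$ be a Finsler metric function: $C^\infty$ and positive off the zero section, positively homogeneous of degree $1$ in $y$, with positive definite fundamental tensor $g_{ij}=\tfrac12\dot\partial_i\dot\partial_jL^2$. Let $\sigma\in C^\infty(M)$, let $\beta=b_i(x)y^i$ be a smooth $1$-form on $M$, and assume that the $\beta$-conformal change $\overline L(x,y)=e^{\sigma(x)}L(x,y)+\beta(x,y)$ is again a Finsler metric function. Work in an arbitrary chart of $M$, with induced coordinates $(x^i,y^i)$ on $TM$, $\partial_i=\partial/\partial x^i$, $\dot\partial_i=\partial/\partial y^i$; repeated indices are summed, and an index $0$ denotes contraction with $y$. Put $L_i=\dot\partial_iL$, $L_{ij}=\dot\partial_jL_i$, $L_{ijk}=\dot\partial_kL_{ij}$, $\overline L_i=\dot\partial_i\overline L$. Let $\Gamma^i_{jk}$ be the (horizontal) coefficients of the Cartan connection of $(M,L)$, $$\Gamma^i_{jk}=\tfrac12g^{il}(\delta_jg_{lk}+\delta_kg_{lj}-\delta_lg_{jk}),\qquad \delta_k=\partial_k-N^r_k\dot\partial_r,$$ where $N^i_j=\gamma^i_{jk}y^k-C^i_{jk}\gamma^k_{rs}y^ry^s$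 $(=\Gamma^i_{jk}y^k)$, $\gamma^i_{jk}=\tfrac12g^{il}(\partial_jg_{lk}+\partial_kg_{lj}-\partial_lg_{jk})$ and $C^i_{jk}=\tfrac12g^{il}\dot\partial_kg_{lj}$. Let $\overline\Gamma{}^i_{jk}$ be the corresponding coefficients for $(M,\overline L)$, and let $$D^i_{jk}=\overline\Gamma{}^i_{jk}-\Gamma^i_{jk},\qquad D^r_{0j}=D^r_{ij}y^i,\qquad D^r_{00}=D^r_{ij}y^iy^j.$$ With $b_{i|j}=\delta_jb_i-b_r\Gamma^r_{ij}$ put $E_{ij}=\tfrac12(b_{i|j}+b_{j|i})$, $F_{ij}=\tfrac12(b_{i|j}-b_{j|i})$, and with $\sigma_i=\partial_i\sigma$ put $\sigma_0=\sigma_iy^i$, $\mu_{ij}=\sigma_iL_j-\sigma_jL_i$. Define $$G_{ij}=e^{-\sigma}F_{ij}-\tfrac12L_{ijr}D^r_{00}+\tfrac12(\sigma_0L_{ij}-\mu_{ij}),\qquad G_i=E_{0i}-\tfrac12e^{\sigma}L_{ir}D^r_{00}+\tfrac12e^{\sigma}(\sigma_0L_i+\sigma_iL).$$ Then, at every $x$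 in the chart domain and every $y\ne0$, for all indices $i,j,r$, $$G_{ij}=\tfrac12L_{ir}\,\dot\partial_jD^r_{00},\qquad G_j=\tfrac12\overline L_r\,\dot\partial_jD^r_{00},\qquad \dot\partial_jD^r_{00}=2D^r_{0j}.$$ -/

import Mathlib

open scoped Manifold ContDiff

noncomputable section

namespace Finsler

/-- Coordinate space, for positions `x = (x^i)` as well as for tangent vectors `y = (y^i)`. -/
abbrev Coord (n : ℕ) : Type := EuclideanSpace ℝ (Fin n)

/-! ### Finsler geometry in local coordinates

A function on (the part over a chart of) the tangent bundle is a function `f x y`. In this section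
`L` is the local expression of a Finsler function, and all quantities are built from it. -/

section Local

variable {n : ℕ}

/-- `∂_i f`: the partial derivative with respect to `x^i`. -/
def pdx (i : Fin n) (f : Coord n → Coord n → ℝ) (x y : Coord n) : ℝ :=
  fderiv ℝ (fun x' => f x' y) x (EuclideanSpace.single i 1)

/-- `∂̇_i f`: the partial derivative with respect to `y^i`. -/
def pdy (i : Fin n) (f : Coord n → Coord n → ℝ) (x y : Coord n) : ℝ :=
  fderiv ℝ (fun y' => f x y') y (EuclideanSpace.single i 1)

/-- The fundamental tensor `g_{ij} = ½ ∂̇_i ∂̇_j L²`. -/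
def gLow (L : Coord n → Coord n → ℝ) (i j : Fin n) (x y : Coord n) : ℝ :=
  (1 / 2) * pdy i (pdy j (fun x' y' => L x' y' ^ 2)) x y

/-- The matrix `(g_{ij})` at `(x, y)`. -/
def gMat (L : Coord n → Coord n → ℝ) (x y : Coord n) : Matrix (Fin n) (Fin n) ℝ :=
  Matrix.of fun i j => gLow L i j x y

/-- `g^{ij}`: the entries of the inverse of the matrix `(g_{ij})`. -/
def gUp (L : Coord n → Coord n → ℝ) (i j : Fin n) (x y : Coord n) : ℝ :=
  (gMat L x y)⁻¹ i j

/-- `L_i = ∂̇_i L`. -/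
def L₁ (L : Coord n → Coord n → ℝ) (i : Fin n) : Coord n → Coord n → ℝ :=
  pdy i L

/-- `L_{ij} = ∂̇_j L_i`. -/
def L₂ (L : Coord n → Coord n → ℝ) (i j : Fin n) : Coord n → Coord n → ℝ :=
  pdy j (L₁ L i)

/-- `L_{ijk} = ∂̇_k L_{ij}`. -/
def L₃ (L : Coord n → Coord n → ℝ) (i j k : Fin n) : Coord n → Coord n → ℝ :=
  pdy k (L₂ L i j)

/-- The Cartan tensor `C_{ijk} = ½ ∂̇_k g_{ij}`. -/
def cLow (L : Coord n → Coord n → ℝ) (i j k : Fin n) (x y : Coord n) : ℝ :=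
  (1 / 2) * pdy k (gLow L i j) x y

/-- `C^i_{jk} = g^{il} C_{ljk}`. -/
def cUp (L : Coord n → Coord n → ℝ) (i j k : Fin n) (x y : Coord n) : ℝ :=
  ∑ l, gUp L i l x y * cLow L l j k x y

/-- The formal Christoffel symbols
`γ^i_{jk} = ½ g^{il} (∂_j g_{lk} + ∂_k g_{lj} - ∂_l g_{jk})` of the fundamental tensor. -/
def formalChristoffel (L : Coord n → Coord n → ℝ) (i j k : Fin n) (x y : Coord n) : ℝ :=
  (1 / 2) * ∑ l, gUp L i l x y *
    (pdx j (gLow L l k) x y + pdx k (gLow L l j) x y - pdx l (gLow L j k) x y)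

/-- The coefficients of the Cartan (canonical, Barthel) nonlinear connection
`N^i_j = γ^i_{jk} y^k - C^i_{jk} γ^k_{rs} y^r y^s`. They are equal to `Γ^i_{jk} y^k` for the
coefficients `Γ` of the Cartan connection below. -/
def nonlinearConn (L : Coord n → Coord n → ℝ) (i j : Fin n) (x y : Coord n) : ℝ :=
  (∑ k, formalChristoffel L i j k x y * y k) -
    ∑ k, cUp L i j k x y * ∑ r, ∑ s, formalChristoffel L k r s x y * y r * y s

/-- `δ_k = ∂_k - N^r_k ∂̇_r`. -/
def deltaD (L : Coord n → Coord n → ℝ) (k : Fin n) (f : Coord n → Coord n → ℝ)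
    (x y : Coord n) : ℝ :=
  pdx k f x y - ∑ r, nonlinearConn L r k x y * pdy r f x y

/-- The horizontal coefficients of the Cartan connection
`Γ^i_{jk} = ½ g^{il} (δ_j g_{lk} + δ_k g_{lj} - δ_l g_{jk})`. -/
def cartanConn (L : Coord n → Coord n → ℝ) (i j k : Fin n) (x y : Coord n) : ℝ :=
  (1 / 2) * ∑ l, gUp L i l x y *
    (deltaD L j (gLow L l k) x y + deltaD L k (gLow L l j) x y - deltaD L l (gLow L j k) x y)

/-- The horizontal covariant derivative `X_{i|j} = δ_j X_i - X_r Γ^r_{ij}` of a covector field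
with components `X_i(x, y)`, with respect to the Cartan connection of `L`. -/
def hCov (L : Coord n → Coord n → ℝ) (X : Fin n → Coord n → Coord n → ℝ) (i j : Fin n)
    (x y : Coord n) : ℝ :=
  deltaD L j (X i) x y - ∑ r, X r x y * cartanConn L r i j x y

end Local

/-! ### The tensors of a change `L ↦ L̄ = e^σ L + β`, in local coordinates

Here `L`, `L'` are the local expressions of the two Finsler functions `L`, `L̄`, and `s x`, `b i x`
are the local expressions of `σ` and of the components of `β = b_i(x) y^i`. -/

section Change

variable {n : ℕ}

/-- The difference tensor `D^i_{jk} = Γ̄^i_{jk} - Γ^i_{jk}` of the two Cartan connections. -/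
def diffTensor (L L' : Coord n → Coord n → ℝ) (i j k : Fin n) (x y : Coord n) : ℝ :=
  cartanConn L' i j k x y - cartanConn L i j k x y

/-- `D^r_{0j} = D^r_{ij} y^i`. -/
def diffTensor0 (L L' : Coord n → Coord n → ℝ) (r j : Fin n) (x y : Coord n) : ℝ :=
  ∑ i, diffTensor L L' r i j x y * y i

/-- `D^r_{00} = D^r_{ij} y^i y^j`. -/
def diffTensor00 (L L' : Coord n → Coord n → ℝ) (r : Fin n) (x y : Coord n) : ℝ :=
  ∑ i, ∑ j, diffTensor L L' r i j x y * y i * y j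

/-- `b_{i|j}`. -/
def bCov (L : Coord n → Coord n → ℝ) (b : Fin n → Coord n → ℝ) (i j : Fin n)
    (x y : Coord n) : ℝ :=
  hCov L (fun k x' _ => b k x') i j x y

/-- `E_{ij} = ½ (b_{i|j} + b_{j|i})`. -/
def tensorE (L : Coord n → Coord n → ℝ) (b : Fin n → Coord n → ℝ) (i j : Fin n)
    (x y : Coord n) : ℝ :=
  (1 / 2) * (bCov L b i j x y + bCov L b j i x y)

/-- `F_{ij} = ½ (b_{i|j} - b_{j|i})`. -/
def tensorF (L : Coord n → Coord n → ℝ) (b : Fin n → Coord n → ℝ) (i j : Fin n)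
    (x y : Coord n) : ℝ :=
  (1 / 2) * (bCov L b i j x y - bCov L b j i x y)

/-- `σ_i = ∂σ/∂x^i`. -/
def sigma₁ (s : Coord n → ℝ) (i : Fin n) (x : Coord n) : ℝ :=
  fderiv ℝ s x (EuclideanSpace.single i 1)

/-- `σ_0 = σ_i y^i`. -/
def sigma0 (s : Coord n → ℝ) (x y : Coord n) : ℝ :=
  ∑ i, sigma₁ s i x * y i

/-- `μ_{ij} = σ_i L_j - σ_j L_i`. -/
def tensorMu (L : Coord n → Coord n → ℝ) (s : Coord n → ℝ) (i j : Fin n) (x y : Coord n) : ℝ :=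
  sigma₁ s i x * L₁ L j x y - sigma₁ s j x * L₁ L i x y

/-- `G_{ij} = e^{-σ} F_{ij} - ½ L_{ijr} D^r_{00} + ½ (σ_0 L_{ij} - μ_{ij})`. -/
def tensorG₂ (L L' : Coord n → Coord n → ℝ) (s : Coord n → ℝ) (b : Fin n → Coord n → ℝ)
    (i j : Fin n) (x y : Coord n) : ℝ :=
  Real.exp (-s x) * tensorF L b i j x y
    - (1 / 2) * (∑ r, L₃ L i j r x y * diffTensor00 L L' r x y)
    + (1 / 2) * (sigma0 s x y * L₂ L i j x y - tensorMu L s i j x y)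

/-- `G_i = E_{0i} - ½ e^σ L_{ir} D^r_{00} + ½ e^σ (σ_0 L_i + σ_i L)`. -/
def tensorG₁ (L L' : Coord n → Coord n → ℝ) (s : Coord n → ℝ) (b : Fin n → Coord n → ℝ)
    (i : Fin n) (x y : Coord n) : ℝ :=
  (∑ k, tensorE L b k i x y * y k)
    - (1 / 2) * Real.exp (s x) * (∑ r, L₂ L i r x y * diffTensor00 L L' r x y)
    + (1 / 2) * Real.exp (s x) * (sigma0 s x y * L₁ L i x y + sigma₁ s i x * L x y)

end Change

/-! ### Finsler manifolds and their local expressions -/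

section Manifold

variable {n : ℕ} {M : Type*} [TopologicalSpace M] [ChartedSpace (Coord n) M]

/-- The tangent vector of `M` at the point `e⁻¹(x)` with components `y` in the chart `e`. -/
def chartVec (e : OpenPartialHomeomorph M (Coord n)) (x y : Coord n) :
    TangentBundle (𝓡 n) M :=
  ⟨e.symm x, mfderiv (𝓡 n) (𝓡 n) e.symm x y⟩

/-- The local expression `f(x, y)`, in the chart `e`, of a function `f` on the tangent bundle. -/
def localExpr (e : OpenPartialHomeomorph M (Coord n)) (f : TangentBundle (𝓡 n) M → ℝ)
    (x y : Coord n) : ℝ :=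
  f (chartVec e x y)

/-- The components `b_i(x)`, in the chart `e`, of a 1-form `β`. -/
def formComp (e : OpenPartialHomeomorph M (Coord n)) (β : ∀ p : M, TangentSpace (𝓡 n) p →ₗ[ℝ] ℝ)
    (i : Fin n) (x : Coord n) : ℝ :=
  β (e.symm x) (chartVec e x (EuclideanSpace.single i 1)).2

/-- A 1-form is smooth if it is smooth as a (fibrewise linear) function on the tangent bundle. -/
def IsSmoothForm [IsManifold (𝓡 n) ∞ M] (β : ∀ p : M, TangentSpace (𝓡 n) p →ₗ[ℝ] ℝ) : Prop :=
  ContMDiff (𝓡 n).tangent 𝓘(ℝ, ℝ) ∞ (fun v : TangentBundle (𝓡 n) M => β v.1 v.2)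

/-- `L` is a Finsler metric function on the smooth manifold `M`: it is smooth and positive off the
zero section, positively homogeneous of degree one, and its fundamental tensor is positive
definite (in every chart of the smooth structure). -/
structure IsFinsler [IsManifold (𝓡 n) ∞ M] (L : TangentBundle (𝓡 n) M → ℝ) : Prop where
  smooth : ContMDiffOn (𝓡 n).tangent 𝓘(ℝ, ℝ) ∞ L {v | v.2 ≠ 0}
  pos : ∀ v : TangentBundle (𝓡 n) M, v.2 ≠ 0 → 0 < L v
  homog : ∀ (p : M) (v : TangentSpace (𝓡 n) p) (c : ℝ), 0 < c → L ⟨p, c • v⟩ = c * L ⟨p, v⟩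
  posDef : ∀ e ∈ IsManifold.maximalAtlas (𝓡 n) ∞ M, ∀ x ∈ e.target, ∀ y : Coord n, y ≠ 0 →
    (gMat (localExpr e L) x y).PosDef

/-- The β-conformal change `L̄(x, y) = e^{σ(x)} L(x, y) + β(x, y)` of `L`. -/
def betaConformal (L : TangentBundle (𝓡 n) M → ℝ) (σ : M → ℝ)
    (β : ∀ p : M, TangentSpace (𝓡 n) p →ₗ[ℝ] ℝ) (v : TangentBundle (𝓡 n) M) : ℝ :=
  Real.exp (σ v.1) * L v + β v.1 v.2

end Manifold

end Finsler

end

/-! In one chart everything reduces to first-order identities for a single Finsler function. Write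
`S^i = γ^i_{00}` for the spray. Lowering an index with the invertible matrix `g` gives `g_{il} S^l =
∂_k(L L_i) y^k - L ∂_i L`. Differentiating this in the fibre yields `∂̇_j S^i = 2 N^i_j`
(`pdy_spray`). Together with `N^i_j y^j = S^i` and `Γ^i_{jk} y^k = N^i_j`, this makes `D^r_{00}` the
difference of the two sprays and `D^r_{0j}` the difference of the two nonlinear connections. The
third identity follows, and the first two become formulas for `L_{ir} D^r_{0j}` and `L̄_r D^r_{0j}`.

Those come from the contracted or antisymmetrised forms of `L_{|j} = 0`, `L_{i|j} = 0` and `L_{ij|k}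
= 0`, which hold for `L` and `L̄` alike. Since `β` is linear in `y`, `L̄_i = e^σ L_i + b_i`,
`L̄_{ij} = e^σ L_{ij}` and `L̄_{ijk} = e^σ L_{ijk}`. For `G_{ij}`, the symmetry of `δ_j L_i` gives
the antisymmetric part of `L_{ir} D^r_{0j}` and `L_{ij|k} y^k = 0` gives the symmetric part. For
`G_j`, two expressions for `L̄_r N̄^r_j`, from `L̄_{|j} = 0` and `L̄_{j|k} y^k = 0`, are averaged.
-/

noncomputable section

namespace Finsler

/-! ### Partial derivatives of functions smooth off the zero section. -/

section Calculus

variable {n : ℕ} {U : Set (Coord n)} {f g : Coord n → Coord n → ℝ} {x y : Coord n}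

/-- `f(x, y)` is smooth for `x ∈ U` and `y ≠ 0`. -/
def SmoothOff (U : Set (Coord n)) (f : Coord n → Coord n → ℝ) : Prop :=
  ContDiffOn ℝ ∞ (Function.uncurry f) (U ×ˢ {0}ᶜ)

theorem isOpen_prod_compl_zero (hU : IsOpen U) : IsOpen (U ×ˢ ({0}ᶜ : Set (Coord n))) :=
  hU.prod isOpen_compl_singleton

theorem SmoothOff.contDiffAt (hf : SmoothOff U f) (hU : IsOpen U) (hx : x ∈ U) (hy : y ≠ 0) :
    ContDiffAt ℝ ∞ (Function.uncurry f) (x, y) :=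
  ContDiffOn.contDiffAt hf ((isOpen_prod_compl_zero hU).mem_nhds ⟨hx, hy⟩)

theorem SmoothOff.differentiableAt (hf : SmoothOff U f) (hU : IsOpen U) (hx : x ∈ U)
    (hy : y ≠ 0) : DifferentiableAt ℝ (Function.uncurry f) (x, y) :=
  (hf.contDiffAt hU hx hy).differentiableAt (by simp)

theorem SmoothOff.differentiableAt_left (hf : SmoothOff U f) (hU : IsOpen U) (hx : x ∈ U)
    (hy : y ≠ 0) : DifferentiableAt ℝ (fun x' => f x' y) x :=
  (hf.differentiableAt hU hx hy).comp (f := fun x' => (x', y)) x (by fun_prop)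

theorem SmoothOff.differentiableAt_right (hf : SmoothOff U f) (hU : IsOpen U) (hx : x ∈ U)
    (hy : y ≠ 0) : DifferentiableAt ℝ (fun y' => f x y') y :=
  (hf.differentiableAt hU hx hy).comp (f := fun y' => (x, y')) y (by fun_prop)

theorem SmoothOff.congr (hf : SmoothOff U f) (h : ∀ x ∈ U, ∀ y, y ≠ 0 → g x y = f x y) :
    SmoothOff U g :=
  ContDiffOn.congr hf fun p hp => h p.1 hp.1 p.2 hp.2

theorem SmoothOff.add (hf : SmoothOff U f) (hg : SmoothOff U g) :
    SmoothOff U (fun x y => f x y + g x y) :=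
  ContDiffOn.add hf hg

theorem SmoothOff.sub (hf : SmoothOff U f) (hg : SmoothOff U g) :
    SmoothOff U (fun x y => f x y - g x y) :=
  ContDiffOn.sub hf hg

theorem SmoothOff.mul (hf : SmoothOff U f) (hg : SmoothOff U g) :
    SmoothOff U (fun x y => f x y * g x y) :=
  ContDiffOn.mul hf hg

theorem SmoothOff.pow (hf : SmoothOff U f) (k : ℕ) : SmoothOff U (fun x y => f x y ^ k) :=
  ContDiffOn.pow hf k

theorem SmoothOff.inv (hf : SmoothOff U f) (h : ∀ x ∈ U, ∀ y, y ≠ 0 → f x y ≠ 0) :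
    SmoothOff U (fun x y => (f x y)⁻¹) :=
  ContDiffOn.inv hf fun p hp => h p.1 hp.1 p.2 hp.2

theorem SmoothOff.const (c : ℝ) : SmoothOff U (fun _ _ => c) :=
  contDiffOn_const

theorem SmoothOff.sum {ι : Type*} {s : Finset ι} {F : ι → Coord n → Coord n → ℝ}
    (hF : ∀ i ∈ s, SmoothOff U (F i)) : SmoothOff U (fun x y => ∑ i ∈ s, F i x y) :=
  ContDiffOn.sum hF

theorem SmoothOff.prod {ι : Type*} {s : Finset ι} {F : ι → Coord n → Coord n → ℝ}
    (hF : ∀ i ∈ s, SmoothOff U (F i)) : SmoothOff U (fun x y => ∏ i ∈ s, F i x y) :=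
  contDiffOn_prod hF

theorem SmoothOff.coord (i : Fin n) : SmoothOff U (fun _ y => y i) := by
  have : ContDiff ℝ ∞ (fun p : Coord n × Coord n => p.2 i) := by fun_prop
  exact this.contDiffOn

theorem SmoothOff.base {h : Coord n → ℝ} (hh : ContDiffOn ℝ ∞ h U) :
    SmoothOff U (fun x _ => h x) :=
  hh.comp contDiff_fst.contDiffOn fun _ hp => hp.1

theorem SmoothOff.det {ι : Type*} [Fintype ι] [DecidableEq ι]
    {A : Coord n → Coord n → Matrix ι ι ℝ} (hA : ∀ i j, SmoothOff U (fun x y => A x y i j)) :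
    SmoothOff U (fun x y => (A x y).det) := by
  simp only [Matrix.det_apply']
  exact SmoothOff.sum fun τ _ => (SmoothOff.const _).mul (SmoothOff.prod fun i _ => hA _ _)

/-- Cramer's rule: each entry of the inverse is a determinant of smooth entries divided by a
nonvanishing determinant. -/
theorem SmoothOff.matrix_inv {ι : Type*} [Fintype ι] [DecidableEq ι]
    {A : Coord n → Coord n → Matrix ι ι ℝ} (hA : ∀ i j, SmoothOff U (fun x y => A x y i j))
    (hdet : ∀ x ∈ U, ∀ y, y ≠ 0 → (A x y).det ≠ 0) (i j : ι) :
    SmoothOff U (fun x y => (A x y)⁻¹ i j) := by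
  simp only [Matrix.inv_def, Matrix.smul_apply, smul_eq_mul, Ring.inverse_eq_inv',
    Matrix.adjugate_apply]
  refine ((SmoothOff.det hA).inv hdet).mul (SmoothOff.det fun k l => ?_)
  simp only [Matrix.updateRow_apply]
  split_ifs
  · exact SmoothOff.const _
  · exact hA k l

/-- Passing from slice derivatives to the joint derivative makes joint smoothness and the symmetry
of second derivatives available. -/
theorem pdx_eq_fderiv (hf : SmoothOff U f) (hU : IsOpen U) (hx : x ∈ U) (hy : y ≠ 0)
    (i : Fin n) :
    pdx i f x y = fderiv ℝ (Function.uncurry f) (x, y) (EuclideanSpace.single i 1, 0) := by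
  have h := (hf.differentiableAt hU hx hy).hasFDerivAt.comp (f := fun x' => (x', y)) x
    (hasFDerivAt_prodMk_left x y)
  have h' : fderiv ℝ (fun x' => f x' y) x = _ := h.fderiv
  simp [pdx, h']

theorem pdy_eq_fderiv (hf : SmoothOff U f) (hU : IsOpen U) (hx : x ∈ U) (hy : y ≠ 0)
    (i : Fin n) :
    pdy i f x y = fderiv ℝ (Function.uncurry f) (x, y) (0, EuclideanSpace.single i 1) := by
  have h := (hf.differentiableAt hU hx hy).hasFDerivAt.comp (f := fun y' => (x, y')) y
    (hasFDerivAt_prodMk_right x y)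
  have h' : fderiv ℝ (fun y' => f x y') y = _ := h.fderiv
  simp [pdy, h']

theorem SmoothOff.fderiv_apply (hf : SmoothOff U f) (hU : IsOpen U) (v : Coord n × Coord n) :
    SmoothOff U (fun x y => fderiv ℝ (Function.uncurry f) (x, y) v) :=
  (ContDiffOn.fderiv_of_isOpen (m := ∞) hf (isOpen_prod_compl_zero hU) (by simp)).clm_apply
    contDiffOn_const

theorem SmoothOff.pdx (hf : SmoothOff U f) (hU : IsOpen U) (i : Fin n) :
    SmoothOff U (pdx i f) :=
  (hf.fderiv_apply hU _).congr fun _ hx _ hy => pdx_eq_fderiv hf hU hx hy i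

theorem SmoothOff.pdy (hf : SmoothOff U f) (hU : IsOpen U) (i : Fin n) :
    SmoothOff U (pdy i f) :=
  (hf.fderiv_apply hU _).congr fun _ hx _ hy => pdy_eq_fderiv hf hU hx hy i

/-- The geometric formulas hold only over `U` and off the zero section; openness lets them be
differentiated there. -/
theorem pdx_congr (hU : IsOpen U) (hx : x ∈ U) (hy : y ≠ 0)
    (h : ∀ x ∈ U, ∀ y, y ≠ 0 → f x y = g x y) (i : Fin n) : pdx i f x y = pdx i g x y := by
  have : (fun x' => f x' y) =ᶠ[nhds x] fun x' => g x' y := by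
    filter_upwards [hU.mem_nhds hx] with x' hx' using h x' hx' y hy
  simp only [pdx, this.fderiv_eq]

theorem pdy_congr (hx : x ∈ U) (hy : y ≠ 0)
    (h : ∀ x ∈ U, ∀ y, y ≠ 0 → f x y = g x y) (i : Fin n) : pdy i f x y = pdy i g x y := by
  have : (fun y' => f x y') =ᶠ[nhds y] fun y' => g x y' := by
    filter_upwards [isOpen_compl_singleton.mem_nhds hy] with y' hy' using h x hx y' hy'
  simp only [pdy, this.fderiv_eq]

theorem fderiv_fderiv_comm (hf : SmoothOff U f) (hU : IsOpen U) (hx : x ∈ U) (hy : y ≠ 0)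
    (v w : Coord n × Coord n) :
    fderiv ℝ (fun p => fderiv ℝ (Function.uncurry f) p v) (x, y) w =
      fderiv ℝ (fun p => fderiv ℝ (Function.uncurry f) p w) (x, y) v := by
  have h := hf.contDiffAt hU hx hy
  have hd : DifferentiableAt ℝ (fderiv ℝ (Function.uncurry f)) (x, y) :=
    (h.fderiv_right (m := 1) (by norm_cast)).differentiableAt (by simp)
  have hs : IsSymmSndFDerivAt ℝ (Function.uncurry f) (x, y) :=
    h.isSymmSndFDerivAt (by simpa using WithTop.coe_le_coe.2 (le_top : (2 : ℕ∞) ≤ ⊤))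
  rw [fderiv_clm_apply hd (by fun_prop), fderiv_clm_apply hd (by fun_prop)]
  simpa using hs w v

theorem pdy_pdx (hf : SmoothOff U f) (hU : IsOpen U) (hx : x ∈ U) (hy : y ≠ 0) (i j : Fin n) :
    pdy i (pdx j f) x y = pdx j (pdy i f) x y := by
  rw [pdy_congr hx hy (fun x hx y hy => pdx_eq_fderiv hf hU hx hy j) i,
    pdx_congr hU hx hy (fun x hx y hy => pdy_eq_fderiv hf hU hx hy i) j,
    pdy_eq_fderiv (hf.fderiv_apply hU _) hU hx hy, pdx_eq_fderiv (hf.fderiv_apply hU _) hU hx hy]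
  exact fderiv_fderiv_comm hf hU hx hy _ _

theorem pdy_pdy (hf : SmoothOff U f) (hU : IsOpen U) (hx : x ∈ U) (hy : y ≠ 0) (i j : Fin n) :
    pdy i (pdy j f) x y = pdy j (pdy i f) x y := by
  rw [pdy_congr hx hy (fun x hx y hy => pdy_eq_fderiv hf hU hx hy j) i,
    pdy_congr hx hy (fun x hx y hy => pdy_eq_fderiv hf hU hx hy i) j,
    pdy_eq_fderiv (hf.fderiv_apply hU _) hU hx hy, pdy_eq_fderiv (hf.fderiv_apply hU _) hU hx hy]
  exact fderiv_fderiv_comm hf hU hx hy _ _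

theorem pdx_add (hf : SmoothOff U f) (hg : SmoothOff U g) (hU : IsOpen U) (hx : x ∈ U)
    (hy : y ≠ 0) (i : Fin n) :
    pdx i (fun x y => f x y + g x y) x y = pdx i f x y + pdx i g x y := by
  simp only [pdx]
  rw [fderiv_fun_add (hf.differentiableAt_left hU hx hy) (hg.differentiableAt_left hU hx hy)]
  rfl

theorem pdy_add (hf : SmoothOff U f) (hg : SmoothOff U g) (hU : IsOpen U) (hx : x ∈ U)
    (hy : y ≠ 0) (i : Fin n) :
    pdy i (fun x y => f x y + g x y) x y = pdy i f x y + pdy i g x y := by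
  simp only [pdy]
  rw [fderiv_fun_add (hf.differentiableAt_right hU hx hy) (hg.differentiableAt_right hU hx hy)]
  rfl

theorem pdy_sub (hf : SmoothOff U f) (hg : SmoothOff U g) (hU : IsOpen U) (hx : x ∈ U)
    (hy : y ≠ 0) (i : Fin n) :
    pdy i (fun x y => f x y - g x y) x y = pdy i f x y - pdy i g x y := by
  simp only [pdy]
  rw [fderiv_fun_sub (hf.differentiableAt_right hU hx hy) (hg.differentiableAt_right hU hx hy)]
  rfl

theorem pdx_mul (hf : SmoothOff U f) (hg : SmoothOff U g) (hU : IsOpen U) (hx : x ∈ U)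
    (hy : y ≠ 0) (i : Fin n) :
    pdx i (fun x y => f x y * g x y) x y = pdx i f x y * g x y + f x y * pdx i g x y := by
  simp only [pdx]
  rw [fderiv_fun_mul (hf.differentiableAt_left hU hx hy) (hg.differentiableAt_left hU hx hy)]
  simp
  ring

theorem pdy_mul (hf : SmoothOff U f) (hg : SmoothOff U g) (hU : IsOpen U) (hx : x ∈ U)
    (hy : y ≠ 0) (i : Fin n) :
    pdy i (fun x y => f x y * g x y) x y = pdy i f x y * g x y + f x y * pdy i g x y := by
  simp only [pdy]
  rw [fderiv_fun_mul (hf.differentiableAt_right hU hx hy) (hg.differentiableAt_right hU hx hy)]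
  simp
  ring

theorem pdx_sum {ι : Type*} {s : Finset ι} {F : ι → Coord n → Coord n → ℝ}
    (hF : ∀ i ∈ s, SmoothOff U (F i)) (hU : IsOpen U) (hx : x ∈ U) (hy : y ≠ 0) (j : Fin n) :
    pdx j (fun x y => ∑ i ∈ s, F i x y) x y = ∑ i ∈ s, pdx j (F i) x y := by
  simp only [pdx]
  rw [fderiv_fun_sum fun i hi => (hF i hi).differentiableAt_left hU hx hy]
  simp

theorem pdy_sum {ι : Type*} {s : Finset ι} {F : ι → Coord n → Coord n → ℝ}
    (hF : ∀ i ∈ s, SmoothOff U (F i)) (hU : IsOpen U) (hx : x ∈ U) (hy : y ≠ 0) (j : Fin n) :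
    pdy j (fun x y => ∑ i ∈ s, F i x y) x y = ∑ i ∈ s, pdy j (F i) x y := by
  simp only [pdy]
  rw [fderiv_fun_sum fun i hi => (hF i hi).differentiableAt_right hU hx hy]
  simp

theorem pdy_base (h : Coord n → ℝ) (i : Fin n) (x y : Coord n) :
    pdy i (fun x _ => h x) x y = 0 := by
  simp [pdy]

theorem pdx_fibre (h : Coord n → ℝ) (i : Fin n) (x y : Coord n) :
    pdx i (fun _ y => h y) x y = 0 := by
  simp [pdx]

theorem pdy_coord (i j : Fin n) (x y : Coord n) :
    pdy i (fun _ y => y j) x y = if j = i then 1 else 0 := by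
  have : fderiv ℝ (fun y : Coord n => y j) y = EuclideanSpace.proj j :=
    (EuclideanSpace.proj (𝕜 := ℝ) j).fderiv
  simp [pdy, this]

/-- Differentiating a contraction with `y` in the direction of the base. -/
theorem pdx_sum_mul_coord {F : Fin n → Coord n → Coord n → ℝ} (hF : ∀ i, SmoothOff U (F i))
    (hU : IsOpen U) (hx : x ∈ U) (hy : y ≠ 0) (j : Fin n) :
    pdx j (fun x y => ∑ k, F k x y * y k) x y = ∑ k, pdx j (F k) x y * y k := by
  rw [pdx_sum (fun i _ => (hF i).mul (SmoothOff.coord i)) hU hx hy]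
  refine Finset.sum_congr rfl fun k _ => ?_
  rw [pdx_mul (hF k) (SmoothOff.coord k) hU hx hy, pdx_fibre (fun y => y k)]
  ring

/-- Differentiating a contraction with `y` in the direction of the fibre. -/
theorem pdy_sum_mul_coord {F : Fin n → Coord n → Coord n → ℝ} (hF : ∀ i, SmoothOff U (F i))
    (hU : IsOpen U) (hx : x ∈ U) (hy : y ≠ 0) (j : Fin n) :
    pdy j (fun x y => ∑ k, F k x y * y k) x y = (∑ k, pdy j (F k) x y * y k) + F j x y := by
  rw [pdy_sum (fun i _ => (hF i).mul (SmoothOff.coord i)) hU hx hy]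
  have : ∀ k, pdy j (fun x y => F k x y * y k) x y =
      pdy j (F k) x y * y k + if k = j then F k x y else 0 := by
    intro k
    rw [pdy_mul (hF k) (SmoothOff.coord k) hU hx hy, pdy_coord]
    simp
  simp [this, Finset.sum_add_distrib]

end Calculus

/-! ### Finsler geometry of one function over an open coordinate domain. -/

section LocalGeometry

variable {n : ℕ} {U : Set (Coord n)} {L : Coord n → Coord n → ℝ} {x y : Coord n}

/-- Euler's identity for functions that are positively homogeneous of degree one in `y`. -/
theorem sum_pdy_mul_coord_of_homog {f : Coord n → Coord n → ℝ} (hf : SmoothOff U f)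
    (hU : IsOpen U) (hom : ∀ c : ℝ, 0 < c → f x (c • y) = c * f x y) (hx : x ∈ U) (hy : y ≠ 0) :
    ∑ i, pdy i f x y * y i = f x y := by
  have hd := (hf.differentiableAt_right hU hx hy).hasFDerivAt
  -- The map `c ↦ f(x, c y)` is differentiated at `c = 1` twice: by the chain rule, and by
  -- homogeneity, which is needed only for `c` near 1.
  have h1 : HasDerivAt (fun c : ℝ => f x (c • y)) (fderiv ℝ (fun y' => f x y') y y) 1 := by
    have hc : HasDerivAt (fun c : ℝ => c • y) y 1 := by
      simpa using (hasDerivAt_id (1 : ℝ)).smul_const y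
    have hd' : HasFDerivAt (fun y' => f x y') (fderiv ℝ (fun y' => f x y') y) ((1 : ℝ) • y) := by
      simpa using hd
    exact hd'.comp_hasDerivAt (1 : ℝ) hc
  have h2 : HasDerivAt (fun c : ℝ => f x (c • y)) (f x y) 1 := by
    have : HasDerivAt (fun c : ℝ => c * f x y) (f x y) 1 := by
      simpa using (hasDerivAt_id (1 : ℝ)).mul_const (f x y)
    refine this.congr_of_eventuallyEq ?_
    filter_upwards [lt_mem_nhds one_pos] with c hc using hom c hc
  rw [← h1.unique h2]
  have hy' : y = ∑ i, y i • EuclideanSpace.single i (1 : ℝ) := by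
    simpa using ((EuclideanSpace.basisFun (Fin n) ℝ).sum_repr y).symm
  have h3 : ∀ T : Coord n →L[ℝ] ℝ, T y = ∑ i, T (EuclideanSpace.single i 1) * y i := by
    intro T
    conv_lhs => rw [hy', map_sum]
    exact Finset.sum_congr rfl fun i _ => by rw [map_smul, smul_eq_mul, mul_comm]
  exact (h3 _).symm

/-- The properties of a local expression of a Finsler function over an open set `U` of
positions on which the connection theory depends. -/
structure IsLocalFinsler (U : Set (Coord n)) (L : Coord n → Coord n → ℝ) : Prop where
  isOpen : IsOpen U
  smooth : SmoothOff U L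
  pos : ∀ x ∈ U, ∀ y, y ≠ 0 → 0 < L x y
  euler : ∀ x ∈ U, ∀ y, y ≠ 0 → ∑ i, L₁ L i x y * y i = L x y
  det_ne_zero : ∀ x ∈ U, ∀ y, y ≠ 0 → (gMat L x y).det ≠ 0

/-- The covector `½ ∂̇_i L²`. -/
def momentum (L : Coord n → Coord n → ℝ) (i : Fin n) (x y : Coord n) : ℝ :=
  (1 / 2) * pdy i (fun x' y' => L x' y' ^ 2) x y

/-- `γ^i_{00}`, twice the geodesic spray coefficients. -/
def spray (L : Coord n → Coord n → ℝ) (i : Fin n) (x y : Coord n) : ℝ :=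
  ∑ r, ∑ s, formalChristoffel L i r s x y * y r * y s

namespace IsLocalFinsler

theorem smooth_L₁ (h : IsLocalFinsler U L) (i : Fin n) : SmoothOff U (L₁ L i) :=
  h.smooth.pdy h.isOpen i

theorem smooth_L₂ (h : IsLocalFinsler U L) (i j : Fin n) : SmoothOff U (L₂ L i j) :=
  (h.smooth_L₁ i).pdy h.isOpen j

theorem smooth_momentum (h : IsLocalFinsler U L) (i : Fin n) : SmoothOff U (momentum L i) :=
  (SmoothOff.const _).mul ((h.smooth.pow 2).pdy h.isOpen i)

theorem L₂_symm (h : IsLocalFinsler U L) (hx : x ∈ U) (hy : y ≠ 0) (i j : Fin n) :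
    L₂ L i j x y = L₂ L j i x y :=
  pdy_pdy h.smooth h.isOpen hx hy j i

/-- Differentiating Euler's identity in `y^i` produces an extra `L_i`, which cancels the right-hand
side. -/
theorem sum_L₂_mul_coord (h : IsLocalFinsler U L) (hx : x ∈ U) (hy : y ≠ 0) (i : Fin n) :
    ∑ j, L₂ L i j x y * y j = 0 := by
  have h1 := pdy_congr hx hy h.euler i
  rw [pdy_sum_mul_coord h.smooth_L₁ h.isOpen hx hy] at h1
  have h2 : ∀ j, pdy i (L₁ L j) x y = L₂ L i j x y := fun j => h.L₂_symm hx hy j i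
  simp only [h2] at h1
  have h3 : pdy i L x y = L₁ L i x y := rfl
  linarith

theorem momentum_eq (h : IsLocalFinsler U L) (hx : x ∈ U) (hy : y ≠ 0) (i : Fin n) :
    momentum L i x y = L x y * L₁ L i x y := by
  have h1 := pdy_mul h.smooth h.smooth h.isOpen hx hy i
  simp only [momentum, pow_two, h1, L₁]
  ring

theorem gLow_eq_pdy_momentum (h : IsLocalFinsler U L) (hx : x ∈ U) (hy : y ≠ 0)
    (i j : Fin n) : gLow L i j x y = pdy i (momentum L j) x y := by
  have h1 := pdy_mul (SmoothOff.const (1 / 2)) ((h.smooth.pow 2).pdy h.isOpen j) h.isOpen hx hy i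
  rw [pdy_base (fun _ => (1 / 2 : ℝ))] at h1
  simp only [zero_mul, zero_add] at h1
  exact h1.symm

theorem smooth_gLow (h : IsLocalFinsler U L) (i j : Fin n) : SmoothOff U (gLow L i j) :=
  ((h.smooth_momentum j).pdy h.isOpen i).congr fun _ hx _ hy =>
    h.gLow_eq_pdy_momentum hx hy i j

theorem gLow_symm (h : IsLocalFinsler U L) (hx : x ∈ U) (hy : y ≠ 0) (i j : Fin n) :
    gLow L i j x y = gLow L j i x y := by
  simp only [gLow]
  rw [pdy_pdy (h.smooth.pow 2) h.isOpen hx hy]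

theorem gLow_eq (h : IsLocalFinsler U L) (hx : x ∈ U) (hy : y ≠ 0) (i j : Fin n) :
    gLow L i j x y = L₁ L i x y * L₁ L j x y + L x y * L₂ L i j x y := by
  rw [h.gLow_symm hx hy, h.gLow_eq_pdy_momentum hx hy,
    pdy_congr hx hy (fun x hx y hy => h.momentum_eq hx hy i) j,
    pdy_mul h.smooth (h.smooth_L₁ i) h.isOpen hx hy]
  simp only [L₂, L₁]
  ring

theorem sum_gLow_mul_coord (h : IsLocalFinsler U L) (hx : x ∈ U) (hy : y ≠ 0) (i : Fin n) :
    ∑ j, gLow L i j x y * y j = momentum L i x y := by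
  have h1 : ∀ j, gLow L i j x y * y j =
      L₁ L i x y * (L₁ L j x y * y j) + L x y * (L₂ L i j x y * y j) := by
    intro j
    rw [h.gLow_eq hx hy]
    ring
  simp only [h1, Finset.sum_add_distrib, ← Finset.mul_sum]
  rw [h.euler x hx y hy, h.sum_L₂_mul_coord hx hy, h.momentum_eq hx hy]
  ring

theorem sum_momentum_mul_coord (h : IsLocalFinsler U L) (hx : x ∈ U) (hy : y ≠ 0) :
    ∑ j, momentum L j x y * y j = L x y ^ 2 := by
  simp only [h.momentum_eq hx hy, mul_assoc, ← Finset.mul_sum]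
  rw [h.euler x hx y hy, pow_two]

theorem pdy_gLow_symm (h : IsLocalFinsler U L) (hx : x ∈ U) (hy : y ≠ 0) (i j k : Fin n) :
    pdy k (gLow L i j) x y = pdy k (gLow L j i) x y :=
  pdy_congr hx hy (fun _ hx _ hy => h.gLow_symm hx hy i j) k

theorem pdx_gLow_symm (h : IsLocalFinsler U L) (hx : x ∈ U) (hy : y ≠ 0) (i j k : Fin n) :
    pdx k (gLow L i j) x y = pdx k (gLow L j i) x y :=
  pdx_congr h.isOpen hx hy (fun _ hx _ hy => h.gLow_symm hx hy i j) k

/-- As `g_{ij}` is itself a fibre derivative of the momentum, commuting derivatives give, with the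
symmetry of `g`, the total symmetry of the Cartan tensor. -/
theorem pdy_gLow_swap (h : IsLocalFinsler U L) (hx : x ∈ U) (hy : y ≠ 0) (i j k : Fin n) :
    pdy k (gLow L i j) x y = pdy i (gLow L k j) x y := by
  rw [pdy_congr hx hy (fun _ hx _ hy => h.gLow_eq_pdy_momentum hx hy i j),
    pdy_congr hx hy (fun _ hx _ hy => h.gLow_eq_pdy_momentum hx hy k j),
    pdy_pdy (h.smooth_momentum j) h.isOpen hx hy]

/-- Differentiate `g_{ij} y^j = L L_i` in `y^k`: the derivative of the right-hand side is already
`g_{ik}`. -/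
theorem sum_pdy_gLow_mul_coord (h : IsLocalFinsler U L) (hx : x ∈ U) (hy : y ≠ 0)
    (i k : Fin n) : ∑ j, pdy k (gLow L i j) x y * y j = 0 := by
  have h1 := pdy_congr hx hy (fun _ hx _ hy => h.sum_gLow_mul_coord hx hy i) k
  rw [pdy_sum_mul_coord (h.smooth_gLow i) h.isOpen hx hy, ← h.gLow_eq_pdy_momentum hx hy,
    h.gLow_symm hx hy k i] at h1
  linarith

theorem sum_pdx_gLow_mul_coord (h : IsLocalFinsler U L) (hx : x ∈ U) (hy : y ≠ 0)
    (i k : Fin n) : ∑ j, pdx k (gLow L i j) x y * y j = pdx k (momentum L i) x y := by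
  have h1 := pdx_congr h.isOpen hx hy (fun _ hx _ hy => h.sum_gLow_mul_coord hx hy i) k
  rwa [pdx_sum_mul_coord (h.smooth_gLow i) h.isOpen hx hy] at h1

theorem sum_pdx_momentum_mul_coord (h : IsLocalFinsler U L) (hx : x ∈ U) (hy : y ≠ 0)
    (k : Fin n) : ∑ j, pdx k (momentum L j) x y * y j = 2 * (L x y * pdx k L x y) := by
  have h1 := pdx_congr h.isOpen hx hy (fun _ hx _ hy => h.sum_momentum_mul_coord hx hy) k
  rw [pdx_sum_mul_coord h.smooth_momentum h.isOpen hx hy] at h1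
  rw [h1]
  simp only [pow_two]
  rw [pdx_mul h.smooth h.smooth h.isOpen hx hy]
  ring

/-! ### Lowering indices; the spray and the nonlinear connection. -/

theorem sum_gLow_mul_sum_gUp (h : IsLocalFinsler U L) (hx : x ∈ U) (hy : y ≠ 0)
    (T : Fin n → ℝ) (i : Fin n) :
    ∑ l, gLow L i l x y * ∑ m, gUp L l m x y * T m = T i := by
  have h1 : gMat L x y * (gMat L x y)⁻¹ = 1 :=
    Matrix.mul_nonsing_inv _ (isUnit_iff_ne_zero.2 (h.det_ne_zero x hx y hy))
  have h2 := congrFun (Matrix.mulVec_mulVec T (gMat L x y) (gMat L x y)⁻¹) i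
  rw [h1, Matrix.one_mulVec] at h2
  exact h2

/-- Identities with an upper index are checked after lowering it, so the inverse matrix is never
differentiated explicitly. -/
theorem eq_of_sum_gLow_mul_eq (h : IsLocalFinsler U L) (hx : x ∈ U) (hy : y ≠ 0)
    {v w : Fin n → ℝ} (hvw : ∀ i, ∑ l, gLow L i l x y * v l = ∑ l, gLow L i l x y * w l)
    (l : Fin n) : v l = w l := by
  have h1 : Function.Injective (gMat L x y).mulVec :=
    Matrix.mulVec_injective_of_isUnit
      ((Matrix.isUnit_iff_isUnit_det _).2 (isUnit_iff_ne_zero.2 (h.det_ne_zero x hx y hy)))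
  exact congrFun (h1 (funext hvw)) l

theorem smooth_gUp (h : IsLocalFinsler U L) (i j : Fin n) : SmoothOff U (gUp L i j) :=
  SmoothOff.matrix_inv (A := gMat L) (fun i j => h.smooth_gLow i j) h.det_ne_zero i j

theorem smooth_formalChristoffel (h : IsLocalFinsler U L) (i j k : Fin n) :
    SmoothOff U (formalChristoffel L i j k) :=
  (SmoothOff.const _).mul (SmoothOff.sum fun l _ => (h.smooth_gUp i l).mul
    ((((h.smooth_gLow l k).pdx h.isOpen j).add ((h.smooth_gLow l j).pdx h.isOpen k)).sub
      ((h.smooth_gLow j k).pdx h.isOpen l)))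

theorem smooth_spray (h : IsLocalFinsler U L) (i : Fin n) : SmoothOff U (spray L i) :=
  SmoothOff.sum fun r _ => SmoothOff.sum fun s _ =>
    ((h.smooth_formalChristoffel i r s).mul (SmoothOff.coord r)).mul (SmoothOff.coord s)

theorem sum_gLow_mul_formalChristoffel (h : IsLocalFinsler U L) (hx : x ∈ U) (hy : y ≠ 0)
    (i j k : Fin n) :
    ∑ l, gLow L i l x y * formalChristoffel L l j k x y =
      (1 / 2) * (pdx j (gLow L i k) x y + pdx k (gLow L i j) x y - pdx i (gLow L j k) x y) := by
  rw [← h.sum_gLow_mul_sum_gUp hx hy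
    (fun l => pdx j (gLow L l k) x y + pdx k (gLow L l j) x y - pdx l (gLow L j k) x y) i,
    Finset.mul_sum]
  exact Finset.sum_congr rfl fun l _ => by simp only [formalChristoffel]; ring

/-- The geodesic spray in Euler–Lagrange form. -/
theorem sum_gLow_mul_spray (h : IsLocalFinsler U L) (hx : x ∈ U) (hy : y ≠ 0) (i : Fin n) :
    ∑ l, gLow L i l x y * spray L l x y =
      (∑ k, pdx k (momentum L i) x y * y k) - L x y * pdx i L x y := by
  have h1 : ∑ l, gLow L i l x y * spray L l x y =
      ∑ r, ∑ s, (∑ l, gLow L i l x y * formalChristoffel L l r s x y) * y r * y s := by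
    simp only [spray, Finset.mul_sum, Finset.sum_mul]
    rw [Finset.sum_comm]
    refine Finset.sum_congr rfl fun r _ => ?_
    rw [Finset.sum_comm]
    exact Finset.sum_congr rfl fun s _ => Finset.sum_congr rfl fun l _ => by ring
  -- After contraction the first two Christoffel terms coincide, and the third gives half of `∂_i L²
  -- = 2 L ∂_i L`.
  have h2 : ∀ r s, (∑ l, gLow L i l x y * formalChristoffel L l r s x y) * y r * y s =
      (1 / 2) * (pdx r (gLow L i s) x y * y s * y r) +
      (1 / 2) * (pdx s (gLow L i r) x y * y r * y s) -
      (1 / 2) * (pdx i (gLow L r s) x y * y s * y r) := by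
    intro r s
    rw [h.sum_gLow_mul_formalChristoffel hx hy]
    ring
  have h3 : ∑ r, ∑ s, pdx s (gLow L i r) x y * y r * y s =
      ∑ k, pdx k (momentum L i) x y * y k := by
    rw [Finset.sum_comm]
    simp only [← Finset.sum_mul, h.sum_pdx_gLow_mul_coord hx hy]
  rw [h1]
  simp only [h2, Finset.sum_sub_distrib, Finset.sum_add_distrib, ← Finset.mul_sum]
  rw [h3]
  simp only [← Finset.sum_mul, h.sum_pdx_gLow_mul_coord hx hy, h.sum_pdx_momentum_mul_coord hx hy]
  ring

theorem sum_gLow_mul_cUp (h : IsLocalFinsler U L) (hx : x ∈ U) (hy : y ≠ 0) (i j k : Fin n) :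
    ∑ l, gLow L i l x y * cUp L l j k x y = (1 / 2) * pdy k (gLow L i j) x y :=
  h.sum_gLow_mul_sum_gUp hx hy (fun l => cLow L l j k x y) i

theorem sum_gLow_mul_nonlinearConn (h : IsLocalFinsler U L) (hx : x ∈ U) (hy : y ≠ 0)
    (i j : Fin n) :
    ∑ l, gLow L i l x y * nonlinearConn L l j x y =
      (1 / 2) * (pdx j (momentum L i) x y + (∑ k, pdx k (gLow L i j) x y * y k) -
        pdx i (momentum L j) x y - ∑ k, pdy k (gLow L i j) x y * spray L k x y) := by
  have h1 : ∑ l, gLow L i l x y * nonlinearConn L l j x y =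
      (∑ k, (∑ l, gLow L i l x y * formalChristoffel L l j k x y) * y k) -
        ∑ k, (∑ l, gLow L i l x y * cUp L l j k x y) * spray L k x y := by
    have hN : ∀ l, nonlinearConn L l j x y = (∑ k, formalChristoffel L l j k x y * y k) -
        ∑ k, cUp L l j k x y * spray L k x y := fun _ => rfl
    simp only [hN, mul_sub, Finset.sum_sub_distrib, Finset.mul_sum,
      Finset.sum_mul]
    rw [Finset.sum_comm]
    conv_lhs =>
      enter [2]
      rw [Finset.sum_comm]
    simp only [mul_assoc]
  have h2 : ∀ k, (1 / 2) * (pdx j (gLow L i k) x y + pdx k (gLow L i j) x y -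
      pdx i (gLow L j k) x y) * y k = (1 / 2) * (pdx j (gLow L i k) x y * y k) +
      (1 / 2) * (pdx k (gLow L i j) x y * y k) - (1 / 2) * (pdx i (gLow L j k) x y * y k) :=
    fun k => by ring
  rw [h1]
  simp only [h.sum_gLow_mul_formalChristoffel hx hy, h.sum_gLow_mul_cUp hx hy, h2,
    Finset.sum_sub_distrib, Finset.sum_add_distrib, ← Finset.mul_sum, mul_assoc,
    h.sum_pdx_gLow_mul_coord hx hy]
  ring

/-- The Cartan nonlinear connection is the fibre derivative of the spray. -/
theorem pdy_spray (h : IsLocalFinsler U L) (hx : x ∈ U) (hy : y ≠ 0) (l j : Fin n) :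
    pdy j (spray L l) x y = 2 * nonlinearConn L l j x y := by
  refine h.eq_of_sum_gLow_mul_eq hx hy (v := fun l => pdy j (spray L l) x y)
    (w := fun l => 2 * nonlinearConn L l j x y) (fun i => ?_) l
  -- The Euler–Lagrange identity is differentiated in `y^j`; the total symmetry of `∂̇_l g_{ij}`
  -- turns the derivative of `g_{il}` into the Cartan-tensor term of `N`.
  have h1 := pdy_congr hx hy (fun _ hx _ hy => h.sum_gLow_mul_spray hx hy i) j
  have hpx : ∀ k, SmoothOff U (pdx k (momentum L i)) := fun k =>
    (h.smooth_momentum i).pdx h.isOpen k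
  rw [pdy_sum (fun l _ => (h.smooth_gLow i l).mul (h.smooth_spray l)) h.isOpen hx hy,
    pdy_sub (SmoothOff.sum fun k _ => (hpx k).mul (SmoothOff.coord k))
      (h.smooth.mul (h.smooth.pdx h.isOpen i)) h.isOpen hx hy,
    pdy_sum_mul_coord hpx h.isOpen hx hy] at h1
  have h2 : ∀ l, pdy j (fun x y => gLow L i l x y * spray L l x y) x y =
      pdy l (gLow L i j) x y * spray L l x y + gLow L i l x y * pdy j (spray L l) x y := by
    intro l
    rw [pdy_mul (h.smooth_gLow i l) (h.smooth_spray l) h.isOpen hx hy,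
      h.pdy_gLow_symm hx hy i l, h.pdy_gLow_swap hx hy l i j, h.pdy_gLow_symm hx hy j i]
  have h3 : ∀ k, pdy j (pdx k (momentum L i)) x y = pdx k (gLow L i j) x y := by
    intro k
    rw [pdy_pdx (h.smooth_momentum i) h.isOpen hx hy, h.pdx_gLow_symm hx hy i j]
    exact pdx_congr h.isOpen hx hy
      (fun _ hx _ hy => (h.gLow_eq_pdy_momentum hx hy j i).symm) k
  have h4 : pdy j (fun x y => L x y * pdx i L x y) x y = pdx i (momentum L j) x y := by
    rw [pdy_mul h.smooth (h.smooth.pdx h.isOpen i) h.isOpen hx hy,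
      pdy_pdx h.smooth h.isOpen hx hy,
      pdx_congr h.isOpen hx hy (fun _ hx _ hy => h.momentum_eq hx hy j) i,
      pdx_mul h.smooth (h.smooth_L₁ j) h.isOpen hx hy]
    simp only [L₁]
    ring
  simp only [h2, h3, h4, Finset.sum_add_distrib] at h1
  have h5 : ∀ l, gLow L i l x y * (2 * nonlinearConn L l j x y) =
      2 * (gLow L i l x y * nonlinearConn L l j x y) := fun l => by ring
  simp only [h5, ← Finset.mul_sum, h.sum_gLow_mul_nonlinearConn hx hy]
  linarith

theorem sum_nonlinearConn_mul_coord (h : IsLocalFinsler U L) (hx : x ∈ U) (hy : y ≠ 0)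
    (l : Fin n) : ∑ j, nonlinearConn L l j x y * y j = spray L l x y := by
  refine h.eq_of_sum_gLow_mul_eq hx hy (v := fun l => ∑ j, nonlinearConn L l j x y * y j)
    (w := fun l => spray L l x y) (fun i => ?_) l
  have h1 : ∑ l, gLow L i l x y * ∑ j, nonlinearConn L l j x y * y j =
      ∑ j, (∑ l, gLow L i l x y * nonlinearConn L l j x y) * y j := by
    simp only [Finset.mul_sum, Finset.sum_mul]
    rw [Finset.sum_comm]
    simp only [mul_assoc]
  have h2 : ∑ j, (∑ k, pdx k (gLow L i j) x y * y k) * y j =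
      ∑ k, pdx k (momentum L i) x y * y k := by
    simp only [Finset.sum_mul]
    rw [Finset.sum_comm]
    simp only [← h.sum_pdx_gLow_mul_coord hx hy i, Finset.sum_mul]
    exact Finset.sum_congr rfl fun k _ => Finset.sum_congr rfl fun j _ => by ring
  -- The Cartan tensor annihilates `y`.
  have h3 : ∑ j, (∑ k, pdy k (gLow L i j) x y * spray L k x y) * y j = 0 := by
    simp only [Finset.sum_mul]
    rw [Finset.sum_comm]
    refine Finset.sum_eq_zero fun k _ => ?_
    rw [← mul_zero (spray L k x y), ← h.sum_pdy_gLow_mul_coord hx hy i k, Finset.mul_sum]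
    exact Finset.sum_congr rfl fun j _ => by ring
  rw [h1, h.sum_gLow_mul_spray hx hy]
  simp only [h.sum_gLow_mul_nonlinearConn hx hy, mul_assoc, ← Finset.mul_sum, sub_mul, add_mul,
    Finset.sum_sub_distrib, Finset.sum_add_distrib]
  rw [h2, h3, h.sum_pdx_momentum_mul_coord hx hy]
  ring

/-! ### The Cartan connection and the horizontal derivatives of `L`. -/

theorem cartanConn_symm (h : IsLocalFinsler U L) (hx : x ∈ U) (hy : y ≠ 0) (i j k : Fin n) :
    cartanConn L i j k x y = cartanConn L i k j x y := by
  simp only [cartanConn]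
  congr 1
  refine Finset.sum_congr rfl fun l _ => ?_
  have : deltaD L l (gLow L j k) x y = deltaD L l (gLow L k j) x y := by
    simp only [deltaD, h.pdx_gLow_symm hx hy j k, h.pdy_gLow_symm hx hy j k]
  rw [this]
  ring

theorem sum_gLow_mul_cartanConn (h : IsLocalFinsler U L) (hx : x ∈ U) (hy : y ≠ 0)
    (i j k : Fin n) :
    ∑ l, gLow L i l x y * cartanConn L l j k x y =
      (1 / 2) * (deltaD L j (gLow L i k) x y + deltaD L k (gLow L i j) x y -
        deltaD L i (gLow L j k) x y) := by
  rw [← h.sum_gLow_mul_sum_gUp hx hy (fun l => deltaD L j (gLow L l k) x y +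
    deltaD L k (gLow L l j) x y - deltaD L l (gLow L j k) x y) i, Finset.mul_sum]
  exact Finset.sum_congr rfl fun l _ => by simp only [cartanConn]; ring

/-- The vertical part of `δ_k` drops out because the Cartan tensor annihilates `y`. -/
theorem sum_deltaD_gLow_mul_coord (h : IsLocalFinsler U L) (hx : x ∈ U) (hy : y ≠ 0)
    (i k : Fin n) : ∑ j, deltaD L k (gLow L i j) x y * y j = pdx k (momentum L i) x y := by
  simp only [deltaD, sub_mul, Finset.sum_sub_distrib, h.sum_pdx_gLow_mul_coord hx hy,
    Finset.sum_mul]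
  rw [Finset.sum_comm]
  have : ∑ r, ∑ j, nonlinearConn L r k x y * pdy r (gLow L i j) x y * y j = 0 := by
    simp only [mul_assoc, ← Finset.mul_sum, h.sum_pdy_gLow_mul_coord hx hy, mul_zero,
      Finset.sum_const_zero]
  rw [this, sub_zero]

theorem sum_deltaD_mul_coord (h : IsLocalFinsler U L) (hx : x ∈ U) (hy : y ≠ 0)
    (f : Coord n → Coord n → ℝ) :
    ∑ k, deltaD L k f x y * y k =
      (∑ k, pdx k f x y * y k) - ∑ r, pdy r f x y * spray L r x y := by
  simp only [deltaD, sub_mul, Finset.sum_sub_distrib, Finset.sum_mul,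
    ← h.sum_nonlinearConn_mul_coord hx hy, Finset.mul_sum]
  congr 1
  rw [Finset.sum_comm]
  exact Finset.sum_congr rfl fun r _ => Finset.sum_congr rfl fun k _ => by ring

/-- The Cartan connection induces the nonlinear connection: `Γ^l_{jk} y^k = N^l_j`. -/
theorem sum_cartanConn_mul_coord (h : IsLocalFinsler U L) (hx : x ∈ U) (hy : y ≠ 0)
    (l j : Fin n) : ∑ k, cartanConn L l j k x y * y k = nonlinearConn L l j x y := by
  refine h.eq_of_sum_gLow_mul_eq hx hy (v := fun l => ∑ k, cartanConn L l j k x y * y k)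
    (w := fun l => nonlinearConn L l j x y) (fun i => ?_) l
  have h1 : ∑ l, gLow L i l x y * ∑ k, cartanConn L l j k x y * y k =
      ∑ k, (∑ l, gLow L i l x y * cartanConn L l j k x y) * y k := by
    simp only [Finset.mul_sum, Finset.sum_mul]
    rw [Finset.sum_comm]
    simp only [mul_assoc]
  rw [h1, h.sum_gLow_mul_nonlinearConn hx hy]
  simp only [h.sum_gLow_mul_cartanConn hx hy, mul_assoc, ← Finset.mul_sum, sub_mul, add_mul,
    Finset.sum_sub_distrib, Finset.sum_add_distrib, h.sum_deltaD_gLow_mul_coord hx hy,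
    h.sum_deltaD_mul_coord hx hy]
  ring

/-- The horizontal derivatives of `L` vanish: `∂_j L = N^l_j L_l`. -/
theorem pdx_eq_sum_nonlinearConn (h : IsLocalFinsler U L) (hx : x ∈ U) (hy : y ≠ 0)
    (j : Fin n) : pdx j L x y = ∑ l, L₁ L l x y * nonlinearConn L l j x y := by
  have hL := h.pos x hx y hy
  -- Contracting the lowered formula for `N` with `y^i` turns `g_{il}` into `L L_l`; the nonzero
  -- factor `L` is cancelled at the end.
  have h1 : ∑ i, (∑ l, gLow L i l x y * nonlinearConn L l j x y) * y i =
      ∑ l, momentum L l x y * nonlinearConn L l j x y := by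
    simp only [Finset.sum_mul]
    rw [Finset.sum_comm]
    refine Finset.sum_congr rfl fun l _ => ?_
    rw [← h.sum_gLow_mul_coord hx hy l, Finset.sum_mul]
    exact Finset.sum_congr rfl fun i _ => by rw [h.gLow_symm hx hy l i]; ring
  have h2 : ∑ i, (∑ k, pdx k (gLow L i j) x y * y k) * y i =
      ∑ k, pdx k (momentum L j) x y * y k := by
    simp only [Finset.sum_mul]
    rw [Finset.sum_comm]
    simp only [← h.sum_pdx_gLow_mul_coord hx hy j, Finset.sum_mul]
    exact Finset.sum_congr rfl fun k _ => Finset.sum_congr rfl fun i _ => by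
      rw [h.pdx_gLow_symm hx hy i j]; ring
  have h3 : ∑ i, (∑ k, pdy k (gLow L i j) x y * spray L k x y) * y i = 0 := by
    simp only [Finset.sum_mul]
    rw [Finset.sum_comm]
    refine Finset.sum_eq_zero fun k _ => ?_
    rw [← mul_zero (spray L k x y), ← h.sum_pdy_gLow_mul_coord hx hy j k, Finset.mul_sum]
    exact Finset.sum_congr rfl fun i _ => by rw [h.pdy_gLow_symm hx hy i j]; ring
  simp only [h.sum_gLow_mul_nonlinearConn hx hy, mul_assoc, ← Finset.mul_sum, sub_mul, add_mul,
    Finset.sum_sub_distrib, Finset.sum_add_distrib] at h1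
  rw [h2, h3, h.sum_pdx_momentum_mul_coord hx hy] at h1
  simp only [h.momentum_eq hx hy, mul_assoc, ← Finset.mul_sum] at h1
  have h4 : L x y * pdx j L x y = L x y * ∑ l, L₁ L l x y * nonlinearConn L l j x y := by
    linarith
  exact mul_left_cancel₀ hL.ne' h4

theorem sum_gLow_mul_nonlinearConn_eq (h : IsLocalFinsler U L) (hx : x ∈ U) (hy : y ≠ 0)
    (i j : Fin n) :
    ∑ l, gLow L i l x y * nonlinearConn L l j x y =
      L₁ L i x y * pdx j L x y + L x y * ∑ l, L₂ L i l x y * nonlinearConn L l j x y := by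
  rw [h.pdx_eq_sum_nonlinearConn hx hy, Finset.mul_sum, Finset.mul_sum, ← Finset.sum_add_distrib]
  exact Finset.sum_congr rfl fun l _ => by rw [h.gLow_eq hx hy]; ring

theorem pdx_momentum_eq (h : IsLocalFinsler U L) (hx : x ∈ U) (hy : y ≠ 0) (i j : Fin n) :
    pdx j (momentum L i) x y = pdx j L x y * L₁ L i x y + L x y * pdx j (L₁ L i) x y := by
  rw [pdx_congr h.isOpen hx hy (fun _ hx _ hy => h.momentum_eq hx hy i) j,
    pdx_mul h.smooth (h.smooth_L₁ i) h.isOpen hx hy]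

/-- The tensor `δ_j L_i` is symmetric. -/
theorem pdx_L₁_sub_symm (h : IsLocalFinsler U L) (hx : x ∈ U) (hy : y ≠ 0) (i j : Fin n) :
    pdx j (L₁ L i) x y - ∑ l, L₂ L i l x y * nonlinearConn L l j x y =
      pdx i (L₁ L j) x y - ∑ l, L₂ L j l x y * nonlinearConn L l i x y := by
  have hL := h.pos x hx y hy
  have h1 := h.sum_gLow_mul_nonlinearConn hx hy i j
  have h2 := h.sum_gLow_mul_nonlinearConn hx hy j i
  -- With the indices of `g` aligned, subtracting `h2` from `h1` removes the terms symmetric in `i,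
  -- j`; what remains is `L` times the claim.
  simp only [h.pdx_gLow_symm hx hy j i, h.pdy_gLow_symm hx hy j i] at h2
  rw [h.sum_gLow_mul_nonlinearConn_eq hx hy] at h1 h2
  rw [h.pdx_momentum_eq hx hy, h.pdx_momentum_eq hx hy] at h1 h2
  refine mul_left_cancel₀ hL.ne' ?_
  linarith

/-- The contraction of `L_{i|j} = 0` with `y^j`. -/
theorem sum_pdx_L₁_mul_coord_sub (h : IsLocalFinsler U L) (hx : x ∈ U) (hy : y ≠ 0)
    (i : Fin n) :
    (∑ j, pdx j (L₁ L i) x y * y j) - ∑ r, L₂ L i r x y * spray L r x y =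
      ∑ r, L₁ L r x y * nonlinearConn L r i x y := by
  have h1 : ∑ j, (pdx j (L₁ L i) x y - ∑ l, L₂ L i l x y * nonlinearConn L l j x y) * y j =
      ∑ j, (pdx i (L₁ L j) x y - ∑ l, L₂ L j l x y * nonlinearConn L l i x y) * y j :=
    Finset.sum_congr rfl fun j _ => by rw [h.pdx_L₁_sub_symm hx hy]
  have h2 : ∑ j, (∑ l, L₂ L i l x y * nonlinearConn L l j x y) * y j =
      ∑ r, L₂ L i r x y * spray L r x y := by
    simp only [← h.sum_nonlinearConn_mul_coord hx hy, Finset.sum_mul, Finset.mul_sum]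
    rw [Finset.sum_comm]
    simp only [mul_assoc]
  have h3 : ∑ j, (∑ l, L₂ L j l x y * nonlinearConn L l i x y) * y j = 0 := by
    simp only [Finset.sum_mul]
    rw [Finset.sum_comm]
    refine Finset.sum_eq_zero fun l _ => ?_
    rw [← mul_zero (nonlinearConn L l i x y), ← h.sum_L₂_mul_coord hx hy l, Finset.mul_sum]
    exact Finset.sum_congr rfl fun j _ => by rw [h.L₂_symm hx hy j l]; ring
  have h4 : ∑ j, pdx i (L₁ L j) x y * y j = pdx i L x y := by
    rw [← pdx_sum_mul_coord h.smooth_L₁ h.isOpen hx hy]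
    exact pdx_congr h.isOpen hx hy h.euler i
  simp only [sub_mul, Finset.sum_sub_distrib] at h1
  rw [h2, h3, h4, sub_zero] at h1
  rw [h1, h.pdx_eq_sum_nonlinearConn hx hy]

/-- The contraction of `L_{ij|k} = 0` with `y^k`. -/
theorem sum_pdx_L₂_mul_coord_sub (h : IsLocalFinsler U L) (hx : x ∈ U) (hy : y ≠ 0)
    (i j : Fin n) :
    (∑ k, pdx k (L₂ L i j) x y * y k) - ∑ r, L₃ L i j r x y * spray L r x y =
      (∑ r, L₂ L j r x y * nonlinearConn L r i x y) +
        ∑ r, L₂ L i r x y * nonlinearConn L r j x y := by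
  have hL := h.pos x hx y hy
  have h1 := h.sum_gLow_mul_nonlinearConn hx hy i j
  have h2 := h.sum_gLow_mul_nonlinearConn hx hy j i
  simp only [h.pdx_gLow_symm hx hy j i, h.pdy_gLow_symm hx hy j i] at h2
  rw [h.sum_gLow_mul_nonlinearConn_eq hx hy] at h1 h2
  -- The sum of `h1` and `h2` loses its antisymmetric momentum terms and gives the derivative of
  -- `g_{ij}` along the spray. Expanding `g_{ij} = L_i L_j + L L_{ij}` leaves `L` times the claim,
  -- once the lower-order terms are removed with `h0`, `hi` and `hj`.
  have hgx : ∀ k, pdx k (gLow L i j) x y * y k =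
      L₁ L j x y * (pdx k (L₁ L i) x y * y k) + L₁ L i x y * (pdx k (L₁ L j) x y * y k) +
      (L₂ L i j x y * (pdx k L x y * y k) + L x y * (pdx k (L₂ L i j) x y * y k)) := by
    intro k
    rw [pdx_congr h.isOpen hx hy (fun _ hx _ hy => h.gLow_eq hx hy i j) k,
      pdx_add ((h.smooth_L₁ i).mul (h.smooth_L₁ j)) (h.smooth.mul (h.smooth_L₂ i j)) h.isOpen hx hy,
      pdx_mul (h.smooth_L₁ i) (h.smooth_L₁ j) h.isOpen hx hy,
      pdx_mul h.smooth (h.smooth_L₂ i j) h.isOpen hx hy]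
    ring
  have hgy : ∀ k, pdy k (gLow L i j) x y * spray L k x y =
      L₁ L j x y * (L₂ L i k x y * spray L k x y) + L₁ L i x y * (L₂ L j k x y * spray L k x y) +
      (L₂ L i j x y * (L₁ L k x y * spray L k x y) +
        L x y * (L₃ L i j k x y * spray L k x y)) := by
    intro k
    rw [pdy_congr hx hy (fun _ hx _ hy => h.gLow_eq hx hy i j) k,
      pdy_add ((h.smooth_L₁ i).mul (h.smooth_L₁ j)) (h.smooth.mul (h.smooth_L₂ i j)) h.isOpen hx hy,
      pdy_mul (h.smooth_L₁ i) (h.smooth_L₁ j) h.isOpen hx hy,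
      pdy_mul h.smooth (h.smooth_L₂ i j) h.isOpen hx hy]
    simp only [L₃, L₂, L₁]
    ring
  have h0 : ∑ k, pdx k L x y * y k = ∑ k, L₁ L k x y * spray L k x y := by
    simp only [h.pdx_eq_sum_nonlinearConn hx hy, ← h.sum_nonlinearConn_mul_coord hx hy,
      Finset.sum_mul, Finset.mul_sum]
    rw [Finset.sum_comm]
    simp only [mul_assoc]
  have hi := h.sum_pdx_L₁_mul_coord_sub hx hy i
  have hj := h.sum_pdx_L₁_mul_coord_sub hx hy j
  rw [← h.pdx_eq_sum_nonlinearConn hx hy] at hi hj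
  simp only [hgx, hgy, Finset.sum_add_distrib, ← Finset.mul_sum] at h1 h2
  rw [h0, sub_eq_iff_eq_add.1 hi, sub_eq_iff_eq_add.1 hj] at h1 h2
  refine mul_left_cancel₀ hL.ne' ?_
  linarith

end IsLocalFinsler

end LocalGeometry

/-! ### The difference tensor and the effect of the change, in coordinates. -/

section LocalChange

variable {n : ℕ} {U : Set (Coord n)} {L L' : Coord n → Coord n → ℝ} {s : Coord n → ℝ}
  {b : Fin n → Coord n → ℝ} {x y : Coord n}

/-- `D^r_{0j}` contracts the first lower index and `Γ^l_{jk} y^k = N^l_j` the second, so the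
symmetry of both connections is needed. -/
theorem diffTensor0_eq (h : IsLocalFinsler U L) (h' : IsLocalFinsler U L') (hx : x ∈ U)
    (hy : y ≠ 0) (r j : Fin n) :
    diffTensor0 L L' r j x y = nonlinearConn L' r j x y - nonlinearConn L r j x y := by
  rw [← h.sum_cartanConn_mul_coord hx hy, ← h'.sum_cartanConn_mul_coord hx hy,
    ← Finset.sum_sub_distrib]
  refine Finset.sum_congr rfl fun i _ => ?_
  rw [diffTensor, h.cartanConn_symm hx hy, h'.cartanConn_symm hx hy, sub_mul]

theorem diffTensor00_eq (h : IsLocalFinsler U L) (h' : IsLocalFinsler U L') (hx : x ∈ U)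
    (hy : y ≠ 0) (r : Fin n) :
    diffTensor00 L L' r x y = spray L' r x y - spray L r x y := by
  rw [← h.sum_nonlinearConn_mul_coord hx hy, ← h'.sum_nonlinearConn_mul_coord hx hy,
    ← Finset.sum_sub_distrib]
  refine Finset.sum_congr rfl fun i _ => ?_
  rw [← h.sum_cartanConn_mul_coord hx hy, ← h'.sum_cartanConn_mul_coord hx hy,
    ← sub_mul, ← Finset.sum_sub_distrib, Finset.sum_mul]
  refine Finset.sum_congr rfl fun j _ => ?_
  rw [diffTensor]
  ring

theorem pdy_diffTensor00 (h : IsLocalFinsler U L) (h' : IsLocalFinsler U L') (hx : x ∈ U)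
    (hy : y ≠ 0) (r j : Fin n) :
    pdy j (diffTensor00 L L' r) x y = 2 * diffTensor0 L L' r j x y := by
  rw [pdy_congr hx hy (fun _ hx _ hy => diffTensor00_eq h h' hx hy r) j,
    pdy_sub (h'.smooth_spray r) (h.smooth_spray r) h.isOpen hx hy, h.pdy_spray hx hy,
    h'.pdy_spray hx hy, diffTensor0_eq h h' hx hy]
  ring

theorem bCov_eq (L : Coord n → Coord n → ℝ) (b : Fin n → Coord n → ℝ) (i j : Fin n)
    (x y : Coord n) :
    bCov L b i j x y = sigma₁ (b i) j x - ∑ r, b r x * cartanConn L r i j x y := by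
  simp only [bCov, hCov, deltaD, pdy_base, mul_zero, Finset.sum_const_zero, sub_zero]
  rfl

/-- The symmetric connection coefficients cancel, so `F` is half the coordinate curl of `b`,
independent of `L`. -/
theorem tensorF_eq (h : IsLocalFinsler U L) (b : Fin n → Coord n → ℝ) (hx : x ∈ U) (hy : y ≠ 0)
    (i j : Fin n) : tensorF L b i j x y = (1 / 2) * (sigma₁ (b i) j x - sigma₁ (b j) i x) := by
  simp only [tensorF, bCov_eq, h.cartanConn_symm hx hy _ j i]
  ring

theorem sum_mul_sum_cartanConn (h : IsLocalFinsler U L) (b : Fin n → Coord n → ℝ) (hx : x ∈ U)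
    (hy : y ≠ 0) (j : Fin n) :
    ∑ k, (∑ r, b r x * cartanConn L r j k x y) * y k =
      ∑ r, b r x * nonlinearConn L r j x y := by
  simp only [← h.sum_cartanConn_mul_coord hx hy, Finset.sum_mul, Finset.mul_sum]
  rw [Finset.sum_comm]
  simp only [mul_assoc]

theorem sum_tensorE_mul_coord (h : IsLocalFinsler U L) (b : Fin n → Coord n → ℝ) (hx : x ∈ U)
    (hy : y ≠ 0) (j : Fin n) :
    ∑ k, tensorE L b k j x y * y k =
      (1 / 2) * ((∑ k, sigma₁ (b k) j x * y k) + ∑ k, sigma₁ (b j) k x * y k) -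
        ∑ r, b r x * nonlinearConn L r j x y := by
  simp only [tensorE, bCov_eq, h.cartanConn_symm hx hy _ _ j, mul_assoc, ← Finset.mul_sum,
    add_mul, sub_mul, Finset.sum_add_distrib, Finset.sum_sub_distrib,
    sum_mul_sum_cartanConn h b hx hy]
  ring

/-- The local form of a β-conformal change of Finsler functions. -/
structure IsLocalBetaConformal (U : Set (Coord n)) (L L' : Coord n → Coord n → ℝ)
    (s : Coord n → ℝ) (b : Fin n → Coord n → ℝ) : Prop where
  left : IsLocalFinsler U L
  right : IsLocalFinsler U L'
  smooth_factor : ContDiffOn ℝ ∞ s U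
  smooth_form : ∀ i, ContDiffOn ℝ ∞ (b i) U
  eq : ∀ x ∈ U, ∀ y, y ≠ 0 → L' x y = Real.exp (s x) * L x y + ∑ i, b i x * y i

/-! ### Derivatives of the changed function, and the two tensor identities. -/

namespace IsLocalBetaConformal

theorem smooth_exp (H : IsLocalBetaConformal U L L' s b) :
    SmoothOff U (fun x _ => Real.exp (s x)) :=
  SmoothOff.base H.smooth_factor.exp

theorem pdx_exp (H : IsLocalBetaConformal U L L' s b) (hx : x ∈ U) (j : Fin n) :
    pdx j (fun x _ => Real.exp (s x)) x y = Real.exp (s x) * sigma₁ s j x := by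
  have hd : DifferentiableAt ℝ s x :=
    (H.smooth_factor.contDiffAt (H.left.isOpen.mem_nhds hx)).differentiableAt (by simp)
  simp only [pdx, sigma₁, fderiv_exp hd]
  rfl

theorem pdx_exp_mul (H : IsLocalBetaConformal U L L' s b) {f : Coord n → Coord n → ℝ}
    (hf : SmoothOff U f) (hx : x ∈ U) (hy : y ≠ 0) (j : Fin n) :
    pdx j (fun x y => Real.exp (s x) * f x y) x y =
      Real.exp (s x) * (sigma₁ s j x * f x y + pdx j f x y) := by
  rw [pdx_mul H.smooth_exp hf H.left.isOpen hx hy, H.pdx_exp hx]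
  ring

theorem pdy_exp_mul (H : IsLocalBetaConformal U L L' s b) {f : Coord n → Coord n → ℝ}
    (hf : SmoothOff U f) (hx : x ∈ U) (hy : y ≠ 0) (j : Fin n) :
    pdy j (fun x y => Real.exp (s x) * f x y) x y = Real.exp (s x) * pdy j f x y := by
  rw [pdy_mul H.smooth_exp hf H.left.isOpen hx hy, pdy_base (fun x => Real.exp (s x))]
  ring

theorem L₁_eq (H : IsLocalBetaConformal U L L' s b) (hx : x ∈ U) (hy : y ≠ 0) (i : Fin n) :
    L₁ L' i x y = Real.exp (s x) * L₁ L i x y + b i x := by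
  have hb : ∀ k, SmoothOff U (fun x _ => b k x) := fun k => SmoothOff.base (H.smooth_form k)
  rw [L₁, pdy_congr hx hy H.eq i,
    pdy_add (H.smooth_exp.mul H.left.smooth)
      (SmoothOff.sum fun k _ => (hb k).mul (SmoothOff.coord k)) H.left.isOpen hx hy,
    H.pdy_exp_mul H.left.smooth hx hy, pdy_sum_mul_coord hb H.left.isOpen hx hy]
  simp [pdy_base, L₁]

/-- `β` is linear along the fibres, so it disappears after two fibre derivatives. -/
theorem L₂_eq (H : IsLocalBetaConformal U L L' s b) (hx : x ∈ U) (hy : y ≠ 0) (i j : Fin n) :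
    L₂ L' i j x y = Real.exp (s x) * L₂ L i j x y := by
  rw [L₂, pdy_congr hx hy (fun _ hx _ hy => H.L₁_eq hx hy i) j,
    pdy_add (H.smooth_exp.mul (H.left.smooth_L₁ i)) (SmoothOff.base (H.smooth_form i))
      H.left.isOpen hx hy,
    H.pdy_exp_mul (H.left.smooth_L₁ i) hx hy, pdy_base (b i), add_zero, L₂]

theorem L₃_eq (H : IsLocalBetaConformal U L L' s b) (hx : x ∈ U) (hy : y ≠ 0) (i j k : Fin n) :
    L₃ L' i j k x y = Real.exp (s x) * L₃ L i j k x y := by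
  rw [L₃, pdy_congr hx hy (fun _ hx _ hy => H.L₂_eq hx hy i j) k,
    H.pdy_exp_mul (H.left.smooth_L₂ i j) hx hy, L₃]

theorem pdx_eq (H : IsLocalBetaConformal U L L' s b) (hx : x ∈ U) (hy : y ≠ 0) (j : Fin n) :
    pdx j L' x y = Real.exp (s x) * (sigma₁ s j x * L x y + pdx j L x y) +
      ∑ k, sigma₁ (b k) j x * y k := by
  have hb : ∀ k, SmoothOff U (fun x _ => b k x) := fun k => SmoothOff.base (H.smooth_form k)
  rw [pdx_congr H.left.isOpen hx hy H.eq j,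
    pdx_add (H.smooth_exp.mul H.left.smooth)
      (SmoothOff.sum fun k _ => (hb k).mul (SmoothOff.coord k)) H.left.isOpen hx hy,
    H.pdx_exp_mul H.left.smooth hx hy, pdx_sum_mul_coord hb H.left.isOpen hx hy]
  rfl

theorem pdx_L₁_eq (H : IsLocalBetaConformal U L L' s b) (hx : x ∈ U) (hy : y ≠ 0)
    (i j : Fin n) :
    pdx j (L₁ L' i) x y = Real.exp (s x) * (sigma₁ s j x * L₁ L i x y + pdx j (L₁ L i) x y) +
      sigma₁ (b i) j x := by
  rw [pdx_congr H.left.isOpen hx hy (fun _ hx _ hy => H.L₁_eq hx hy i) j,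
    pdx_add (H.smooth_exp.mul (H.left.smooth_L₁ i)) (SmoothOff.base (H.smooth_form i))
      H.left.isOpen hx hy,
    H.pdx_exp_mul (H.left.smooth_L₁ i) hx hy]
  rfl

theorem pdx_L₂_eq (H : IsLocalBetaConformal U L L' s b) (hx : x ∈ U) (hy : y ≠ 0)
    (i j k : Fin n) :
    pdx k (L₂ L' i j) x y =
      Real.exp (s x) * (sigma₁ s k x * L₂ L i j x y + pdx k (L₂ L i j) x y) := by
  rw [pdx_congr H.left.isOpen hx hy (fun _ hx _ hy => H.L₂_eq hx hy i j) k,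
    H.pdx_exp_mul (H.left.smooth_L₂ i j) hx hy]

/-- Comparing the two functions gives `L_{ir} D^r_{0j} + L_{jr} D^r_{0i} = σ_0 L_{ij} - L_{ijr}
D^r_{00}` and `L_{ir} D^r_{0j} - L_{jr} D^r_{0i} = 2 e^{-σ} F_{ij} - μ_{ij}`; half their sum is the
claim. -/
theorem tensorG₂_eq (H : IsLocalBetaConformal U L L' s b) (hx : x ∈ U) (hy : y ≠ 0)
    (i j : Fin n) :
    tensorG₂ L L' s b i j x y = ∑ r, L₂ L i r x y * diffTensor0 L L' r j x y := by
  have h := H.left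
  have h' := H.right
  have hb := h.pdx_L₁_sub_symm hx hy i j
  have hd := h.sum_pdx_L₂_mul_coord_sub hx hy i j
  have hb' := h'.pdx_L₁_sub_symm hx hy i j
  have hd' := h'.sum_pdx_L₂_mul_coord_sub hx hy i j
  have h0 : ∑ k, Real.exp (s x) * (sigma₁ s k x * L₂ L i j x y + pdx k (L₂ L i j) x y) * y k =
      Real.exp (s x) * (sigma0 s x y * L₂ L i j x y + ∑ k, pdx k (L₂ L i j) x y * y k) := by
    simp only [sigma0, Finset.sum_mul, ← Finset.sum_add_distrib, Finset.mul_sum]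
    exact Finset.sum_congr rfl fun k _ => by ring
  simp only [H.pdx_L₁_eq hx hy, H.L₂_eq hx hy, mul_assoc, ← Finset.mul_sum] at hb'
  simp only [H.pdx_L₂_eq hx hy, h0] at hd'
  simp only [H.L₃_eq hx hy, H.L₂_eq hx hy, mul_assoc, ← Finset.mul_sum] at hd'
  have hE : Real.exp (s x) ≠ 0 := (Real.exp_pos _).ne'
  -- The common factor `e^σ` is divided out of the identity for `L̄`.
  have hd'' := mul_left_cancel₀ hE ((mul_sub _ _ _).trans (hd'.trans (mul_add _ _ _).symm))
  have hF : Real.exp (-s x) * (sigma₁ (b i) j x - sigma₁ (b j) i x) =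
      (sigma₁ s i x * L₁ L j x y + pdx i (L₁ L j) x y -
        ∑ l, L₂ L j l x y * nonlinearConn L' l i x y) -
      (sigma₁ s j x * L₁ L i x y + pdx j (L₁ L i) x y -
        ∑ l, L₂ L i l x y * nonlinearConn L' l j x y) := by
    rw [Real.exp_neg, inv_mul_eq_iff_eq_mul₀ hE]
    linarith
  simp only [tensorG₂, tensorMu, tensorF_eq h b hx hy, diffTensor00_eq h h' hx hy,
    diffTensor0_eq h h' hx hy, mul_sub, Finset.sum_sub_distrib] at hF ⊢
  linarith

/-- `L̄_r N̄^r_j` equals both `∂_j L̄` and `∂_k L̄_j y^k - L̄_{jr} S̄^r`. Averaging them symmetrises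
`∂_j b_k`, which is how `E_{0j}` arises; then `L̄_r N^r_j` is subtracted. -/
theorem tensorG₁_eq (H : IsLocalBetaConformal U L L' s b) (hx : x ∈ U) (hy : y ≠ 0)
    (j : Fin n) :
    tensorG₁ L L' s b j x y = ∑ r, L₁ L' r x y * diffTensor0 L L' r j x y := by
  have h := H.left
  have h' := H.right
  have ha := h.pdx_eq_sum_nonlinearConn hx hy j
  have hc := h.sum_pdx_L₁_mul_coord_sub hx hy j
  have ha' := h'.pdx_eq_sum_nonlinearConn hx hy j
  have hc' := h'.sum_pdx_L₁_mul_coord_sub hx hy j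
  have h0 : ∑ k, (Real.exp (s x) * (sigma₁ s k x * L₁ L j x y + pdx k (L₁ L j) x y) +
      sigma₁ (b j) k x) * y k =
      Real.exp (s x) * (sigma0 s x y * L₁ L j x y) +
        Real.exp (s x) * (∑ k, pdx k (L₁ L j) x y * y k) + ∑ k, sigma₁ (b j) k x * y k := by
    simp only [sigma0, Finset.sum_mul, ← Finset.sum_add_distrib, Finset.mul_sum]
    exact Finset.sum_congr rfl fun k _ => by ring
  have h1 : ∑ r, L₁ L' r x y * nonlinearConn L r j x y =
      Real.exp (s x) * (∑ r, L₁ L r x y * nonlinearConn L r j x y) +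
        ∑ r, b r x * nonlinearConn L r j x y := by
    rw [Finset.mul_sum, ← Finset.sum_add_distrib]
    exact Finset.sum_congr rfl fun r _ => by rw [H.L₁_eq hx hy]; ring
  simp only [H.pdx_L₁_eq hx hy, h0, H.L₂_eq hx hy, mul_assoc, ← Finset.mul_sum] at hc'
  rw [H.pdx_eq hx hy, ha] at ha'
  rw [sub_eq_iff_eq_add.1 hc] at hc'
  simp only [tensorG₁, sum_tensorE_mul_coord h b hx hy, diffTensor00_eq h h' hx hy,
    diffTensor0_eq h h' hx hy, mul_sub, Finset.sum_sub_distrib, h1]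
  linarith

end IsLocalBetaConformal

end LocalChange

/-! ### From the manifold to local expressions. -/

section Charts

variable {n : ℕ} {M : Type*} [TopologicalSpace M] [ChartedSpace (Coord n) M]
  {e : OpenPartialHomeomorph M (Coord n)}

/-- This is the tangent map of the smooth inverse chart, after identifying pairs `(x, y)` with the
tangent bundle of the model space. -/
theorem contMDiffOn_chartVec [IsManifold (𝓡 n) ∞ M]
    (he : e ∈ IsManifold.maximalAtlas (𝓡 n) ∞ M) :
    ContMDiffOn 𝓘(ℝ, Coord n × Coord n) (𝓡 n).tangent ∞
      (fun p : Coord n × Coord n => chartVec e p.1 p.2) (e.target ×ˢ Set.univ) := by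
  have h1 : ContMDiffOn (𝓡 n) (𝓡 n) ∞ e.symm e.target :=
    contMDiffOn_symm_of_mem_maximalAtlas he
  have h2 := h1.contMDiffOn_tangentMapWithin (m := ∞) (by simp) e.open_target.uniqueMDiffOn
  have h3 : ContMDiff 𝓘(ℝ, Coord n × Coord n) (𝓡 n).tangent ∞
      (fun p : Coord n × Coord n => (⟨p.1, p.2⟩ : TangentBundle (𝓡 n) (Coord n))) := by
    have := contMDiff_tangentBundleModelSpaceHomeomorph_symm (I := 𝓡 n) (n := ∞)
    rw [modelWithCornersSelf_prod]
    exact this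
  refine (h2.comp h3.contMDiffOn fun p hp => hp.1).congr fun p hp => ?_
  simp only [Function.comp, tangentMapWithin, chartVec]
  rw [mfderivWithin_of_isOpen e.open_target hp.1]

/-- The differential of `e.symm` is injective, since that of `e` is a left inverse by the chain
rule. -/
theorem chartVec_snd_ne_zero (he : e ∈ IsManifold.maximalAtlas (𝓡 n) ∞ M) {x y : Coord n}
    (hx : x ∈ e.target) (hy : y ≠ 0) : (chartVec e x y).2 ≠ 0 := by
  have hs : MDifferentiableAt (𝓡 n) (𝓡 n) e.symm x :=
    (contMDiffAt_symm_of_mem_maximalAtlas he hx).mdifferentiableAt (by simp)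
  have ht : MDifferentiableAt (𝓡 n) (𝓡 n) e (e.symm x) :=
    (contMDiffAt_of_mem_maximalAtlas he (e.map_target hx)).mdifferentiableAt (by simp)
  have hc := mfderiv_comp x ht hs
  have hid : mfderiv (𝓡 n) (𝓡 n) (e ∘ e.symm) x = ContinuousLinearMap.id ℝ (Coord n) := by
    have : e ∘ e.symm =ᶠ[nhds x] id := by
      filter_upwards [e.open_target.mem_nhds hx] with z hz using e.right_inv hz
    rw [this.mfderiv_eq]
    exact mfderiv_id
  intro h0
  apply hy
  have h1 := congrArg (fun A : Coord n →L[ℝ] Coord n => A y) (hid.symm.trans hc)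
  have h2 : y = mfderiv (𝓡 n) (𝓡 n) e (e.symm x) (mfderiv (𝓡 n) (𝓡 n) e.symm x y) := h1
  rw [h2]
  have h3 : mfderiv (𝓡 n) (𝓡 n) e.symm x y = 0 := h0
  rw [h3]
  exact map_zero _

theorem smoothOff_localExpr [IsManifold (𝓡 n) ∞ M]
    (he : e ∈ IsManifold.maximalAtlas (𝓡 n) ∞ M)
    {L : TangentBundle (𝓡 n) M → ℝ}
    (hL : ContMDiffOn (𝓡 n).tangent 𝓘(ℝ, ℝ) ∞ L {v | v.2 ≠ 0}) :
    SmoothOff e.target (localExpr e L) := by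
  have h := hL.comp ((contMDiffOn_chartVec he).mono
    (Set.prod_mono_right (s := e.target) (Set.subset_univ {0}ᶜ)))
    fun p hp => chartVec_snd_ne_zero he hp.1 hp.2
  exact h.contDiffOn

theorem localExpr_smul (e : OpenPartialHomeomorph M (Coord n)) {L : TangentBundle (𝓡 n) M → ℝ}
    (hL : ∀ (p : M) (v : TangentSpace (𝓡 n) p) (c : ℝ), 0 < c → L ⟨p, c • v⟩ = c * L ⟨p, v⟩)
    (x y : Coord n) {c : ℝ} (hc : 0 < c) : localExpr e L x (c • y) = c * localExpr e L x y := by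
  simp only [localExpr, chartVec]
  rw [← hL _ _ _ hc]
  congr 2
  exact map_smul (mfderiv (𝓡 n) (𝓡 n) e.symm x) c y

theorem contDiffOn_formComp [IsManifold (𝓡 n) ∞ M]
    (he : e ∈ IsManifold.maximalAtlas (𝓡 n) ∞ M)
    {β : ∀ p : M, TangentSpace (𝓡 n) p →ₗ[ℝ] ℝ} (hβ : IsSmoothForm β) (i : Fin n) :
    ContDiffOn ℝ ∞ (formComp e β i) e.target := by
  have h1 := (ContMDiff.contMDiffOn (s := Set.univ) hβ).comp (contMDiffOn_chartVec he)
    fun p _ => Set.mem_univ _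
  have h2 : ContDiffOn ℝ ∞ _ _ := h1.contDiffOn
  exact h2.comp (f := fun x => (x, EuclideanSpace.single i (1 : ℝ)))
    (by fun_prop) fun x hx => ⟨hx, Set.mem_univ _⟩

theorem contDiffOn_comp_chart_symm (he : e ∈ IsManifold.maximalAtlas (𝓡 n) ∞ M) {σ : M → ℝ}
    (hσ : ContMDiff (𝓡 n) 𝓘(ℝ, ℝ) ∞ σ) :
    ContDiffOn ℝ ∞ (fun x => σ (e.symm x)) e.target :=
  (hσ.comp_contMDiffOn (contMDiffOn_symm_of_mem_maximalAtlas he)).contDiffOn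

theorem localExpr_betaConformal (e : OpenPartialHomeomorph M (Coord n))
    (L : TangentBundle (𝓡 n) M → ℝ) (σ : M → ℝ) (β : ∀ p : M, TangentSpace (𝓡 n) p →ₗ[ℝ] ℝ)
    (x y : Coord n) :
    localExpr e (betaConformal L σ β) x y =
      Real.exp (σ (e.symm x)) * localExpr e L x y + ∑ i, formComp e β i x * y i := by
  simp only [localExpr, betaConformal]
  congr 1
  have hy : y = ∑ i, y i • EuclideanSpace.single i (1 : ℝ) := by
    simpa using ((EuclideanSpace.basisFun (Fin n) ℝ).sum_repr y).symm
  have h : ∀ T : Coord n →ₗ[ℝ] ℝ, T y = ∑ i, T (EuclideanSpace.single i 1) * y i := by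
    intro T
    conv_lhs => rw [hy, map_sum]
    exact Finset.sum_congr rfl fun i _ => by rw [map_smul, smul_eq_mul, mul_comm]
  exact h ((β (e.symm x)).comp (mfderiv (𝓡 n) (𝓡 n) e.symm x).toLinearMap)

/-- Positive definiteness of `g` enters the argument only through the nonvanishing of its
determinant. -/
theorem IsFinsler.isLocalFinsler [IsManifold (𝓡 n) ∞ M]
    {L : TangentBundle (𝓡 n) M → ℝ} (hL : IsFinsler L)
    (he : e ∈ IsManifold.maximalAtlas (𝓡 n) ∞ M) :
    IsLocalFinsler e.target (localExpr e L) where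
  isOpen := e.open_target
  smooth := smoothOff_localExpr he hL.smooth
  pos _ hx _ hy := hL.pos _ (chartVec_snd_ne_zero he hx hy)
  euler x hx y hy := sum_pdy_mul_coord_of_homog (smoothOff_localExpr he hL.smooth) e.open_target
    (fun _ hc => localExpr_smul e hL.homog x y hc) hx hy
  det_ne_zero x hx y hy := (hL.posDef e he x hx y hy).det_pos.ne'

end Charts

end Finsler

end

theorem proposition4p1 {n : ℕ} {M : Type*} [TopologicalSpace M]
    [ChartedSpace (Finsler.Coord n) M] [IsManifold (𝓡 n) ∞ M]
    (L : TangentBundle (𝓡 n) M → ℝ) (hL : Finsler.IsFinsler L)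
    (σ : M → ℝ) (hσ : ContMDiff (𝓡 n) 𝓘(ℝ, ℝ) ∞ σ)
    (β : ∀ p : M, TangentSpace (𝓡 n) p →ₗ[ℝ] ℝ) (hβ : Finsler.IsSmoothForm β)
    (hL' : Finsler.IsFinsler (Finsler.betaConformal L σ β))
    (e : OpenPartialHomeomorph M (Finsler.Coord n))
    (he : e ∈ IsManifold.maximalAtlas (𝓡 n) ∞ M)
    (ℓ ℓ' : Finsler.Coord n → Finsler.Coord n → ℝ)
    (hℓ : ℓ = Finsler.localExpr e L)
    (hℓ' : ℓ' = Finsler.localExpr e (Finsler.betaConformal L σ β))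
    (s : Finsler.Coord n → ℝ) (hs : s = fun x => σ (e.symm x))
    (b : Fin n → Finsler.Coord n → ℝ) (hb : b = Finsler.formComp e β)
    (x : Finsler.Coord n) (hx : x ∈ e.target) (y : Finsler.Coord n) (hy : y ≠ 0) :
    (∀ i j : Fin n, Finsler.tensorG₂ ℓ ℓ' s b i j x y =
      (1 / 2) * ∑ r, Finsler.L₂ ℓ i r x y *
        Finsler.pdy j (Finsler.diffTensor00 ℓ ℓ' r) x y) ∧
    (∀ j : Fin n, Finsler.tensorG₁ ℓ ℓ' s b j x y =
      (1 / 2) * ∑ r, Finsler.L₁ ℓ' r x y *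
        Finsler.pdy j (Finsler.diffTensor00 ℓ ℓ' r) x y) ∧
    (∀ r j : Fin n, Finsler.pdy j (Finsler.diffTensor00 ℓ ℓ' r) x y =
      2 * Finsler.diffTensor0 ℓ ℓ' r j x y) := by
  subst hℓ hℓ' hs hb
  have H : Finsler.IsLocalBetaConformal e.target (Finsler.localExpr e L)
      (Finsler.localExpr e (Finsler.betaConformal L σ β)) (fun x => σ (e.symm x))
      (Finsler.formComp e β) :=
    ⟨hL.isLocalFinsler he, hL'.isLocalFinsler he, Finsler.contDiffOn_comp_chart_symm he hσ,
      Finsler.contDiffOn_formComp he hβ,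
      fun x _ y _ => Finsler.localExpr_betaConformal e L σ β x y⟩
  -- The third identity comes first: it replaces `½ ∂̇_j D^r_{00}` by `D^r_{0j}` in the other two.
  have hD := Finsler.pdy_diffTensor00 H.left H.right hx hy
  refine ⟨fun i j => ?_, fun j => ?_, hD⟩
  · rw [H.tensorG₂_eq hx hy, Finset.mul_sum]
    exact Finset.sum_congr rfl fun r _ => by rw [hD]; ring
  · rw [H.tensorG₁_eq hx hy, Finset.mul_sum]
    exact Finset.sum_congr rfl fun r _ => by rw [hD]; ring
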